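/- Let $r\ge 1$ and let $\gamma_1,\dots,\gamma_r\in\mathbb{C}$ with $\Re\gamma_j>0$ for all $j$. For $c\in\mathbb{R}$ and $t=(t_1,\dots,t_r)\in\mathbb{C}^r$ put $$\widetilde{\mathfrak H}_r(t;\gamma;c)=\prod_{j=1}^r K_c\Bigl(\gamma_j\sum_{k=j}^r t_k\Bigr),\qquad K_c(y)=\frac{1}{e^{y}-1}-\frac{c}{e^{cy}-1},$$ where the removable singularity at $y=0$ is filled in by $K_c(0)=(c-1)/2$. For $\varepsilon>0$ let $\mathcal C=\mathcal C_\varepsilon$ be the Hankel contour: it comes from $+\infty$ to $\varepsilon$ along the top side of the positive real axis (where $\arg t=0$), runs once counterclockwise around the circle $|t|=\varepsilon$, and returns to $+\infty$ along the bottom side (where $\arg t=2\pi$); $t^{s-1}=e^{(s-1)\log t}$ is taken with this argument. The factor $1/((e^{2\pi i s}-1)\Gamma(s))$ is given its limit at its removable singularities $s=0,-1,-2,\dots$. Let $U$ be the set of $(s_j)\in\mathbb{C}^r$ with no $s_j$ in $\{1,2,3,\dots\}$. There is $\varepsilon_0>0$, depending only on $r$ and the $\gamma_j$, such that the following holds for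 every $0<\varepsilon<\varepsilon_0$. (i) There are $\delta>0$ and $A>0$ such that, for all $c\in\mathbb{R}$ with $0<|c-1|<\delta$ and all $t\in\mathcal C^r$, $$\bigl|(c-1)^{-r}\,\widetilde{\mathfrak H}_r(t;\gamma;c)\bigr|\le F(t):=A\prod_{k=1}^r\exp\Bigl(-\Re\bigl(t_k\tfrac{\gamma_1+\cdots+\gamma_k}{2}\bigr)\Bigr),$$ and $\int_{\mathcal C^r}F(t)\prod_{k}|t_k^{s_k-1}\,dt_k|<\infty$ for all $(s_j)\in\mathbb{C}^r$. In particular $\int_{\mathcal C^r}\widetilde{\mathfrak H}_r(t;\gamma;c)\prod_k t_k^{s_k-1}dt_k$ converges absolutely for these $c$ and all $(s_j)\in\mathbb{C}^r$. (ii) For every $(s_j)\in U$ the limit over $c\in\mathbb{R}\setminus\{1\}$ $$\zeta^{\rm des}_r((s_j);(\gamma_j)):=\lim_{c\to1}\frac{(-1)^r}{(c-1)^r}\prod_{k=1}^r\frac{1}{(e^{2\pi i s_k}-1)\Gamma(s_k)}\int_{\mathcal C^r}\widetilde{\mathfrak H}_r(t;\gamma;c)\prod_{k=1}^r t_k^{s_k-1}dt_k$$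 exists, and $$\zeta^{\rm des}_r((s_j);(\gamma_j))=\prod_{k=1}^r\frac{1}{(e^{2\pi i s_k}-1)\Gamma(s_k)}\int_{\mathcal C^r}\lim_{c\to1}\frac{(-1)^r}{(c-1)^r}\widetilde{\mathfrak H}_r(t;\gamma;c)\prod_{k=1}^r t_k^{s_k-1}dt_k$$ $$=\prod_{k=1}^r\frac{1}{(e^{2\pi i s_k}-1)\Gamma(s_k)}\int_{\mathcal C^r}\prod_{j=1}^r\lim_{c\to1}\frac{-1}{c-1}\,K_c\Bigl(\gamma_j\sum_{k=j}^r t_k\Bigr)\prod_{k=1}^r t_k^{s_k-1}dt_k,$$ where the limits under the integral signs exist at every point of $\mathcal C^r$ and the integrals converge absolutely, for all $(s_j)\in\mathbb{C}^r$. (iii) The function $(s_j)\mapsto\zeta^{\rm des}_r((s_j);(\gamma_j))$ on $U$ extends to an entire function on $\mathbb{C}^r$, which is the same for all $0<\varepsilon<\varepsilon_0$. -/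

import Mathlib

open Filter Topology MeasureTheory

noncomputable section

namespace DesZeta

/-- The function `1/(e^y - 1) - c/(e^{cy} - 1)` of `y`, with its removable singularity
at `y = 0` filled in by its limit `(c - 1)/2`. -/
def kernel (c : ℝ) (y : ℂ) : ℂ :=
  if y = 0 then ((c : ℂ) - 1) / 2
  else 1 / (Complex.exp y - 1) - (c : ℂ) / (Complex.exp ((c : ℂ) * y) - 1)

/-- The argument `γ_j (t_j + t_{j+1} + ⋯ + t_r)` of the `j`-th factor. -/
def tailArg {r : ℕ} (γ t : Fin r → ℂ) (j : Fin r) : ℂ :=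
  γ j * ∑ k ∈ Finset.Ici j, t k

/-- The generating function `H̃_r((t_j); (γ_j); c)`. -/
def tildeH {r : ℕ} (γ : Fin r → ℂ) (c : ℝ) (t : Fin r → ℂ) : ℂ :=
  ∏ j, kernel c (tailArg γ t j)

/-- Modulus of the Hankel contour: from `+∞` down to `ε` for `u ≤ 0`, equal to `ε` for
`0 ≤ u ≤ 2π`, from `ε` back to `+∞` for `u ≥ 2π`. -/
def hankelRadius (ε u : ℝ) : ℝ :=
  ε + max (-u) 0 + max (u - 2 * Real.pi) 0

/-- Continuously chosen argument along the Hankel contour: `0` on the top side of the positive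
real axis, `u` on the circle, `2π` on the bottom side. -/
def hankelAngle (u : ℝ) : ℝ :=
  max 0 (min u (2 * Real.pi))

/-- Parametrization by `u ∈ ℝ` of the Hankel contour with circle of radius `ε`. -/
def hankelPoint (ε u : ℝ) : ℂ :=
  (hankelRadius ε u : ℂ) * Complex.exp (Complex.I * (hankelAngle u : ℂ))

/-- `dt/du` for `t = hankelPoint ε u`. -/
def hankelVelocity (ε u : ℝ) : ℂ :=
  if u < 0 then -1
  else if u ≤ 2 * Real.pi then Complex.I * (ε : ℂ) * Complex.exp (Complex.I * (u : ℂ))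
  else 1

/-- The power `t^a` on the Hankel contour, for the branch of `log t` that is real on the top
side and has imaginary part `2π` on the bottom side. -/
def hankelPow (ε u : ℝ) (a : ℂ) : ℂ :=
  Complex.exp (a * ((Real.log (hankelRadius ε u) : ℂ) + Complex.I * (hankelAngle u : ℂ)))

/-- The point `(t_1, …, t_r)` of `𝒞^r` with parameter `(u_1, …, u_r)`. -/
def hankelPoints {r : ℕ} (ε : ℝ) (u : Fin r → ℝ) : Fin r → ℂ :=
  fun k => hankelPoint ε (u k)

/-- The density of `∏ₖ t_k^{s_k - 1} dt_k` with respect to `du_1 ⋯ du_r`. -/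
def hankelWeight {r : ℕ} (ε : ℝ) (s : Fin r → ℂ) (u : Fin r → ℝ) : ℂ :=
  ∏ k, (hankelPow ε (u k) (s k - 1) * hankelVelocity ε (u k))

/-- The integral of `f(t) ∏ₖ t_k^{s_k - 1} dt_k` over `𝒞^r` converges absolutely. -/
def HankelIntegrable {r : ℕ} (ε : ℝ) (s : Fin r → ℂ) (f : (Fin r → ℂ) → ℂ) : Prop :=
  Integrable (fun u : Fin r → ℝ => f (hankelPoints ε u) * hankelWeight ε s u)

/-- The integral of `f(t) ∏ₖ t_k^{s_k - 1} dt_k` over `𝒞^r`. -/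
def hankelIntegral {r : ℕ} (ε : ℝ) (s : Fin r → ℂ) (f : (Fin r → ℂ) → ℂ) : ℂ :=
  ∫ u : Fin r → ℝ, f (hankelPoints ε u) * hankelWeight ε s u

open Classical in
/-- The factor `1/((e^{2πis} - 1) Γ(s))`. At `s = 0, -1, -2, …` its singularity is removable
and it is given its limit there; it has poles at `s = 1, 2, 3, …`. -/
def hankelFactor (s : ℂ) : ℂ :=
  if ∃ n : ℕ, s = -(n : ℂ) then
    limUnder (𝓝[≠] s) (fun z : ℂ =>
      1 / ((Complex.exp (2 * Real.pi * Complex.I * z) - 1) * Complex.Gamma z))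
  else 1 / ((Complex.exp (2 * Real.pi * Complex.I * s) - 1) * Complex.Gamma s)

/-- The points of `ℂ^r` with no coordinate in `{1, 2, 3, …}`: those at which the factors
`1/((e^{2πi s_k} - 1) Γ(s_k))` are finite. -/
def regularPoints (r : ℕ) : Set (Fin r → ℂ) :=
  {s | ∀ k, ∀ n : ℕ, s k ≠ (n : ℂ) + 1}

/-- The expression whose limit as `c → 1` is the desingularized multiple zeta-function. -/
def preDesZeta {r : ℕ} (ε : ℝ) (γ : Fin r → ℂ) (c : ℝ) (s : Fin r → ℂ) : ℂ :=
  (-1) ^ r / ((c : ℂ) - 1) ^ r * (∏ k, hankelFactor (s k)) * hankelIntegral ε s (tildeH γ c)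

/-- The desingularized multiple zeta-function, computed with circles of radius `ε`. -/
def desZeta {r : ℕ} (ε : ℝ) (γ : Fin r → ℂ) (s : Fin r → ℂ) : ℂ :=
  limUnder (𝓝[≠] (1 : ℝ)) (fun c : ℝ => preDesZeta ε γ c s)

/-- The exponential majorant `∏ₖ exp(-Re(t_k (γ_1 + ⋯ + γ_k)/2))`. -/
def majorant {r : ℕ} (γ t : Fin r → ℂ) : ℝ :=
  ∏ k, Real.exp (-(t k * ((∑ j ∈ Finset.Iic k, γ j) / 2)).re)

end DesZeta

end

/-! Put T(z) = z/(e^z - 1), which is `todd`. Since y K_c(y) = T(y) - T(cy), the quantity -K_c(y)/(c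
- 1) is the difference quotient of T between y and cy (`neg_kernel_div`). It tends to T'(y) as c → 1
(`tendsto_kernel`), and by the mean value inequality it is bounded by the supremum of |T'| on the
segment from y to cy. The poles 2πin, n ≠ 0, of T lie at distance at least 2π Re γ/|γ| from the line
ℝγ, so T is holomorphic on a strip around the ray γ[0,∞), and T' decays exponentially there
(`exists_toddDeriv_bound`).

When all t_k lie within a small η of the positive real axis, every argument γ_j(t_j + ⋯ + t_r) lies
in such a strip. Multiplying the bounds over j gives a majorant independent of c
(`exists_majorant_bound`). It beats any power t^{s-1} along the contour, locally uniformly in s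
(`exists_productWeight_bound`), so dominated convergence moves the limit c → 1 under the integral
(`tendsto_hankelIntegral_tildeH`).

The limiting integral is entire in s, because it is a locally dominated integral of entire functions
(`differentiableAt_integral_of_dominated`). By Cauchy's theorem in one variable at a time, it is
independent of the radius (`productIntegral_const_eq`) and vanishes when some s_k is a positive
integer (`productIntegral_eq_zero`). These zeros cancel the simple poles of the factors
1/((e^{2πis_k} - 1)Γ(s_k)). The removal is done one coordinate at a time, which gives the entire
extension (`exists_differentiable_prod_hankelFactor_mul`). -/

namespace DesZeta

/-! ### The function z/(e^z - 1) and its derivative -/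

/-- The entire function `(e^z - 1)/z`. -/
noncomputable def expQuot (z : ℂ) : ℂ := dslope Complex.exp 0 z

/-- The generating function `z/(e^z - 1)` of the Bernoulli numbers. -/
noncomputable def todd (z : ℂ) : ℂ := (expQuot z)⁻¹

/-- The derivative of `todd`. -/
noncomputable def toddDeriv (z : ℂ) : ℂ := -deriv expQuot z / expQuot z ^ 2

theorem differentiable_expQuot : Differentiable ℂ expQuot := by
  have := (Complex.differentiableOn_dslope (c := 0) (s := Set.univ) univ_mem).2
    Complex.differentiable_exp.differentiableOn
  exact differentiableOn_univ.1 this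

theorem expQuot_zero : expQuot 0 = 1 := by
  simp [expQuot, dslope_same]

theorem mul_expQuot (z : ℂ) : z * expQuot z = Complex.exp z - 1 := by
  have := sub_smul_dslope Complex.exp 0 z
  simpa [expQuot] using this

theorem hasDerivAt_todd {z : ℂ} (hz : expQuot z ≠ 0) : HasDerivAt todd (toddDeriv z) z :=
  (differentiable_expQuot z).hasDerivAt.fun_inv hz

theorem differentiable_deriv_expQuot : Differentiable ℂ (deriv expQuot) := by
  have := differentiable_expQuot.differentiableOn (s := Set.univ)
  exact differentiableOn_univ.1 (this.deriv isOpen_univ)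

theorem differentiableAt_toddDeriv {z : ℂ} (hz : expQuot z ≠ 0) :
    DifferentiableAt ℂ toddDeriv z :=
  ((differentiable_deriv_expQuot z).neg).div ((differentiable_expQuot z).pow 2) (pow_ne_zero 2 hz)

theorem expQuot_add_mul_deriv (z : ℂ) : expQuot z + z * deriv expQuot z = Complex.exp z := by
  have h1 : HasDerivAt (fun z => z * expQuot z) (1 * expQuot z + z * deriv expQuot z) z :=
    (hasDerivAt_id z).mul (differentiable_expQuot z).hasDerivAt
  have h2 : HasDerivAt (fun z => z * expQuot z) (Complex.exp z) z := by
    simp only [mul_expQuot]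
    exact (Complex.hasDerivAt_exp z).sub_const 1
  have := h1.unique h2
  simpa using this

theorem deriv_expQuot_zero : deriv expQuot 0 = 1 / 2 := by
  have h1 : HasDerivAt (fun z => expQuot z + z * deriv expQuot z)
      (deriv expQuot 0 + (1 * deriv expQuot 0 + 0 * deriv (deriv expQuot) 0)) 0 :=
    (differentiable_expQuot 0).hasDerivAt.add
      ((hasDerivAt_id (0 : ℂ)).mul (differentiable_deriv_expQuot 0).hasDerivAt)
  have h2 : HasDerivAt (fun z => expQuot z + z * deriv expQuot z) 1 0 := by
    simp only [expQuot_add_mul_deriv]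
    simpa using Complex.hasDerivAt_exp 0
  have := h1.unique h2
  linear_combination this / 2

theorem toddDeriv_zero : toddDeriv 0 = -1 / 2 := by
  simp [toddDeriv, deriv_expQuot_zero, expQuot_zero]; norm_num

theorem toddDeriv_of_ne {z : ℂ} (hz : z ≠ 0) (hE : expQuot z ≠ 0) :
    toddDeriv z = (Complex.exp z - 1 - z * Complex.exp z) / (Complex.exp z - 1) ^ 2 := by
  have h1 := expQuot_add_mul_deriv z
  have h2 := mul_expQuot z
  rw [toddDeriv, ← h2, ← h1]
  field_simp
  ring

/-- The identity y K_c(y) = T(y) - T(cy) with T = `todd`, divided by -(c - 1)y. It turns both the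
limit and the uniform bound as c → 1 into statements about T'. -/
theorem neg_kernel_div (c : ℝ) (hc : c ≠ 1) (hc0 : c ≠ 0) {y : ℂ} (hy : y ≠ 0)
    (h1 : expQuot y ≠ 0) (h2 : expQuot (c * y) ≠ 0) :
    (-1) / ((c : ℂ) - 1) * kernel c y = (todd (c * y) - todd y) / (c * y - y) := by
  have hc' : (c : ℂ) - 1 ≠ 0 := by
    rw [sub_ne_zero]; exact_mod_cast hc
  have hc0' : (c : ℂ) ≠ 0 := by exact_mod_cast hc0
  have e1 : (c : ℂ) * y - y = (c - 1) * y := by ring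
  rw [kernel, if_neg hy, ← mul_expQuot, ← mul_expQuot, todd, todd, e1]
  field_simp
  ring

/-! ### Strips around the rays γ[0,∞) -/

/-- The set `{γx + w : x ≥ 0, |w| ≤ η}`. -/
def halfStrip (γ : ℂ) (η : ℝ) : Set ℂ := {z | ∃ x : ℝ, 0 ≤ x ∧ ‖z - γ * x‖ ≤ η}

/-- The radius `π Re γ / |γ|` for which `halfStrip γ` avoids the points `2πin`, `n ≠ 0`. -/
noncomputable def stripRadius (γ : ℂ) : ℝ := Real.pi * γ.re / ‖γ‖

theorem stripRadius_pos {γ : ℂ} (hγ : 0 < γ.re) : 0 < stripRadius γ := by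
  have : 0 < ‖γ‖ := hγ.trans_le (Complex.re_le_norm γ)
  unfold stripRadius; positivity

theorem stripRadius_le {γ : ℂ} (hγ : 0 < γ.re) : stripRadius γ ≤ Real.pi := by
  have : 0 < ‖γ‖ := hγ.trans_le (Complex.re_le_norm γ)
  unfold stripRadius
  rw [div_le_iff₀ this]
  exact mul_le_mul_of_nonneg_left (Complex.re_le_norm γ) Real.pi_pos.le

theorem smul_mem_halfStrip {γ : ℂ} {η τ : ℝ} (hτ : 0 ≤ τ) {z : ℂ} (hz : z ∈ halfStrip γ η) :
    (τ : ℂ) * z ∈ halfStrip γ (τ * η) := by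
  obtain ⟨x, hx, h⟩ := hz
  refine ⟨τ * x, by positivity, ?_⟩
  have : (τ : ℂ) * z - γ * ((τ * x : ℝ) : ℂ) = τ * (z - γ * x) := by push_cast; ring
  rw [this, norm_mul, Complex.norm_real, Real.norm_of_nonneg hτ]
  gcongr

theorem halfStrip_mono (γ : ℂ) {η η' : ℝ} (h : η ≤ η') : halfStrip γ η ⊆ halfStrip γ η' :=
  fun _ ⟨x, hx, hz⟩ => ⟨x, hx, hz.trans h⟩

theorem re_ge_of_mem_halfStrip {γ : ℂ} {η x : ℝ} {z : ℂ} (h : ‖z - γ * x‖ ≤ η) :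
    γ.re * x - η ≤ z.re := by
  have := (Complex.abs_re_le_norm (z - γ * x)).trans h
  simp at this
  linarith [(abs_le.1 this).1]

/-- The nonzero multiples of `2πi` stay away from the strip. -/
theorem expQuot_ne_zero {γ : ℂ} (hγ : 0 < γ.re) {z : ℂ}
    (hz : z ∈ halfStrip γ (stripRadius γ)) : expQuot z ≠ 0 := by
  obtain ⟨x, hx, h⟩ := hz
  intro hE
  have hz0 : z ≠ 0 := by
    rintro rfl; simp [expQuot_zero] at hE
  have hexp : Complex.exp z = 1 := by
    have := mul_expQuot z; rw [hE, mul_zero] at this; exact (sub_eq_zero.1 this.symm)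
  obtain ⟨n, rfl⟩ := Complex.exp_eq_one_iff.1 hexp
  have hn : n ≠ 0 := by rintro rfl; simp at hz0
  have hγ0 : 0 < ‖γ‖ := hγ.trans_le (Complex.re_le_norm γ)
  -- project onto the normal of the ray
  have h3 : |((starRingEnd ℂ γ) * (n * (2 * Real.pi * Complex.I) - γ * x)).im|
      ≤ ‖γ‖ * stripRadius γ := by
    refine (Complex.abs_im_le_norm _).trans ?_
    rw [norm_mul, Complex.norm_conj]
    gcongr
  have h4 : ((starRingEnd ℂ γ) * (n * (2 * Real.pi * Complex.I) - γ * x)).im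
      = γ.re * (n * (2 * Real.pi)) := by
    simp; ring
  rw [h4] at h3
  have h5 : ‖γ‖ * stripRadius γ = Real.pi * γ.re := by
    unfold stripRadius; field_simp
  rw [h5, abs_mul, abs_of_pos hγ, abs_mul, abs_of_pos (by positivity : (0:ℝ) < 2 * Real.pi)] at h3
  have h6 : (1 : ℝ) ≤ |(n : ℝ)| := by exact_mod_cast Int.one_le_abs hn
  have h7 : 0 < γ.re * Real.pi := by positivity
  nlinarith [mul_le_mul_of_nonneg_left h6 h7.le]

theorem norm_le_of_mem_halfStrip {γ : ℂ} {η x : ℝ} (hx : 0 ≤ x) {z : ℂ} (h : ‖z - γ * x‖ ≤ η) :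
    ‖z‖ ≤ ‖γ‖ * x + η := by
  have : z = (z - γ * x) + γ * x := by ring
  rw [this]
  refine (norm_add_le _ _).trans ?_
  rw [norm_mul, Complex.norm_real, Real.norm_of_nonneg hx]
  linarith

/-! ### Exponential decay of the derivative on a strip -/

theorem norm_toddDeriv_le_of_re {z : ℂ} (hz : 1 ≤ z.re) :
    ‖toddDeriv z‖ ≤ 4 * (2 + ‖z‖) * Real.exp (-z.re) := by
  have he : 2 ≤ Real.exp z.re := by
    have := Real.add_one_le_exp z.re; linarith
  have hep : 0 < Real.exp z.re := Real.exp_pos _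
  have hlow : Real.exp z.re / 2 ≤ ‖Complex.exp z - 1‖ := by
    have := norm_sub_norm_le (Complex.exp z) 1
    rw [Complex.norm_exp, norm_one] at this
    linarith
  have hz0 : z ≠ 0 := by rintro rfl; simp at hz; linarith
  have hE : expQuot z ≠ 0 := by
    intro h
    have := mul_expQuot z
    rw [h, mul_zero] at this
    rw [← this, norm_zero] at hlow
    linarith
  rw [toddDeriv_of_ne hz0 hE, norm_div, norm_pow, Real.exp_neg]
  have hnum : ‖Complex.exp z - 1 - z * Complex.exp z‖ ≤ (2 + ‖z‖) * Real.exp z.re := by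
    refine (norm_sub_le _ _).trans ?_
    rw [norm_mul, Complex.norm_exp]
    have := norm_sub_le (Complex.exp z) 1
    rw [Complex.norm_exp, norm_one] at this
    nlinarith
  have hden : (Real.exp z.re) ^ 2 / 4 ≤ ‖Complex.exp z - 1‖ ^ 2 := by
    nlinarith
  calc _ ≤ ((2 + ‖z‖) * Real.exp z.re) / ((Real.exp z.re) ^ 2 / 4) :=
        div_le_div₀ (by positivity) hnum (by positivity) hden
    _ = _ := by field_simp

/-- Where Re z < 1 the strip is relatively compact and T' is continuous. Where Re z ≥ 1 the explicit
formula gives O((1 + |z|)e^{-Re z}), and |z| = O(1 + Re z) on the strip. A quarter of the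
exponential pays for this linear factor, and the rate 3/4 remains. -/
theorem exists_toddDeriv_bound {γ : ℂ} (hγ : 0 < γ.re) :
    ∃ A : ℝ, 0 < A ∧ ∀ z ∈ halfStrip γ (stripRadius γ),
      ‖toddDeriv z‖ ≤ A * Real.exp (-(3 / 4 * z.re)) := by
  set η := stripRadius γ with hη
  have hη0 : 0 < η := stripRadius_pos hγ
  -- Points γx + w of the strip with real part below 1 have x ≤ X₀.
  set X₀ := (1 + η) / γ.re with hX₀
  -- the compact part
  have hK : IsCompact (Set.Icc (0:ℝ) X₀ ×ˢ Metric.closedBall (0:ℂ) η) :=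
    isCompact_Icc.prod (isCompact_closedBall 0 η)
  have hcont : ContinuousOn (fun p : ℝ × ℂ => toddDeriv (γ * p.1 + p.2))
      (Set.Icc (0:ℝ) X₀ ×ˢ Metric.closedBall (0:ℂ) η) := by
    rintro ⟨x, w⟩ ⟨hx, hw⟩
    refine ContinuousAt.continuousWithinAt ?_
    have hd : DifferentiableAt ℂ toddDeriv (γ * x + w) :=
      differentiableAt_toddDeriv (expQuot_ne_zero hγ ⟨x, hx.1, by simpa using hw⟩)
    have hl : Continuous fun p : ℝ × ℂ => γ * p.1 + p.2 := by fun_prop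
    exact ContinuousAt.comp (x := (x, w)) (g := toddDeriv) hd.continuousAt hl.continuousAt
  obtain ⟨B, hB⟩ := hK.exists_bound_of_continuousOn hcont
  set M := 1 + ‖γ‖ / γ.re + (‖γ‖ * η / γ.re + η) with hM
  have hM0 : 0 < M := by positivity
  -- The first summand serves Re z < 1, the second Re z ≥ 1.
  refine ⟨(|B| + 1) * Real.exp 1 + 32 * (2 + M), by positivity, ?_⟩
  rintro z ⟨x, hx, h⟩
  have hre := re_ge_of_mem_halfStrip h
  rcases le_or_gt 1 z.re with h1 | h1
  · have hb := norm_toddDeriv_le_of_re h1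
    have hxle : x ≤ (z.re + η) / γ.re := by
      rw [le_div_iff₀ hγ]; linarith
    have hnz : ‖z‖ ≤ M * (1 + z.re) := by
      have h2 := norm_le_of_mem_halfStrip hx h
      have h3 : ‖γ‖ * x ≤ ‖γ‖ * ((z.re + η) / γ.re) := by gcongr
      have h4 : ‖γ‖ * ((z.re + η) / γ.re) + η = ‖γ‖ / γ.re * z.re + (‖γ‖ * η / γ.re + η) := by
        field_simp
        ring
      have h5 : 0 ≤ ‖γ‖ / γ.re := by positivity
      have h6 : 0 ≤ ‖γ‖ * η / γ.re + η := by positivity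
      nlinarith
    have hexp : 1 + z.re ≤ 4 * Real.exp (z.re / 4) := by
      have := Real.add_one_le_exp (z.re / 4); linarith
    have h7 : 2 + ‖z‖ ≤ (2 + M) * (4 * Real.exp (z.re / 4)) := by nlinarith
    have h8 : Real.exp (z.re / 4) * Real.exp (-z.re) = Real.exp (-(3 / 4 * z.re)) := by
      rw [← Real.exp_add]; congr 1; ring
    calc ‖toddDeriv z‖ ≤ 4 * (2 + ‖z‖) * Real.exp (-z.re) := hb
      _ ≤ 4 * ((2 + M) * (4 * Real.exp (z.re / 4))) * Real.exp (-z.re) := by gcongr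
      _ = 16 * (2 + M) * Real.exp (-(3 / 4 * z.re)) := by rw [← h8]; ring
      _ ≤ _ := by
        gcongr
        have : 0 ≤ (|B| + 1) * Real.exp 1 := by positivity
        linarith
  · have hxle : x ≤ X₀ := by
      rw [hX₀, le_div_iff₀ hγ]; linarith
    have hb := hB (x, z - γ * x) ⟨⟨hx, hxle⟩, by simpa using h⟩
    simp only [add_sub_cancel] at hb
    have he : 1 ≤ Real.exp 1 * Real.exp (-(3 / 4 * z.re)) := by
      rw [← Real.exp_add]; apply Real.one_le_exp; linarith
    calc ‖toddDeriv z‖ ≤ (|B| + 1) * 1 := by linarith [le_abs_self B]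
      _ ≤ (|B| + 1) * (Real.exp 1 * Real.exp (-(3 / 4 * z.re))) := by gcongr
      _ ≤ _ := by
        rw [← mul_assoc]; gcongr
        have : 0 ≤ 32 * (2 + M) := by positivity
        linarith

/-! ### Uniform bound and limit of the kernel as c → 1 -/

/-- For `y` in the smaller strip and `c` near `1`, the kernel is bounded like its derivative. -/
theorem exists_kernel_bound {γ : ℂ} (hγ : 0 < γ.re) :
    ∃ A : ℝ, 0 < A ∧ ∀ y ∈ halfStrip γ (3 / 4 * stripRadius γ),
      ‖toddDeriv y‖ ≤ A * Real.exp (-(y.re / 2)) ∧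
      ∀ c : ℝ, c ≠ 1 → |c - 1| < 1 / 3 →
        ‖(-1) / ((c : ℂ) - 1) * kernel c y‖ ≤ A * Real.exp (-(y.re / 2)) := by
  obtain ⟨A, hA, hbound⟩ := exists_toddDeriv_bound hγ
  have hη := stripRadius_pos hγ
  have hηπ := stripRadius_le hγ
  -- The factor e^π absorbs the part of the strip with Re y < 0, where Re y ≥ -π.
  refine ⟨A * Real.exp Real.pi, by positivity, ?_⟩
  intro y hy
  have hyre : -Real.pi ≤ y.re := by
    obtain ⟨x, hx, h⟩ := hy
    have := re_ge_of_mem_halfStrip h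
    nlinarith [mul_nonneg hγ.le hx]
  -- The constants fit together: scaling by τ ≤ 4/3 carries the strip of 3/4 the radius into the
  -- full strip, and τ ≥ 2/3 turns the decay rate 3/4 into at least 1/2.
  have hmem : ∀ τ : ℝ, 2 / 3 ≤ τ → τ ≤ 4 / 3 → (τ : ℂ) * y ∈ halfStrip γ (stripRadius γ) := by
    intro τ h1 h2
    refine halfStrip_mono γ ?_ (smul_mem_halfStrip (by linarith) hy)
    nlinarith
  have hτ : ∀ τ : ℝ, 2 / 3 ≤ τ → τ ≤ 4 / 3 →
      ‖toddDeriv (τ * y)‖ ≤ A * Real.exp Real.pi * Real.exp (-(y.re / 2)) := by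
    intro τ h1 h2
    refine (hbound _ (hmem τ h1 h2)).trans ?_
    rw [mul_assoc, ← Real.exp_add]
    gcongr
    have : ((τ : ℂ) * y).re = τ * y.re := by simp
    rw [this]
    rcases le_or_gt 0 y.re with h | h
    · nlinarith [Real.pi_pos]
    · nlinarith [Real.pi_pos]
  have hone : ‖toddDeriv y‖ ≤ A * Real.exp Real.pi * Real.exp (-(y.re / 2)) := by
    simpa using hτ 1 (by norm_num) (by norm_num)
  refine ⟨hone, ?_⟩
  intro c hc hc3
  obtain ⟨hc1, hc2⟩ := abs_lt.1 hc3
  have hc' : (c : ℂ) - 1 ≠ 0 := by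
    rw [sub_ne_zero]; exact_mod_cast hc
  by_cases hy0 : y = 0
  · subst hy0
    rw [toddDeriv_zero] at hone
    rw [kernel, if_pos rfl]
    convert hone using 2
    field_simp
  have hcy : (c : ℂ) * y - y ≠ 0 := by
    have : (c : ℂ) * y - y = (c - 1) * y := by ring
    rw [this]; exact mul_ne_zero hc' hy0
  rw [neg_kernel_div c hc (by linarith) hy0
    (expQuot_ne_zero hγ (by simpa using hmem 1 (by norm_num) (by norm_num)))
    (expQuot_ne_zero hγ (hmem c (by linarith) (by linarith))), norm_div, div_le_iff₀ (by positivity)]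
  -- Mean value inequality for T: the segment from y to cy consists of the points τy with τ between
  -- 1 and c, all covered by `hτ`.
  have key := (convex_segment (𝕜 := ℝ) y ((c:ℂ) * y)).norm_image_sub_le_of_norm_hasDerivWithin_le
    (f := todd) (f' := toddDeriv) (C := A * Real.exp Real.pi * Real.exp (-(y.re / 2)))
    (𝕜 := ℂ) ?_ ?_ (left_mem_segment ℝ _ _) (right_mem_segment ℝ _ _)
  · exact key
  all_goals
    rintro z ⟨a, b, ha, hb, hab, rfl⟩
    have hz : a • y + b • ((c : ℂ) * y) = ((a + b * c : ℝ) : ℂ) * y := by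
      simp only [Complex.real_smul]; push_cast; ring
    have ha' : a = 1 - b := by linarith
    have l1 : 2 / 3 ≤ a + b * c := by subst ha'; nlinarith
    have l2 : a + b * c ≤ 4 / 3 := by subst ha'; nlinarith
    rw [hz]
  · exact (hasDerivAt_todd (expQuot_ne_zero hγ (hmem _ l1 l2))).hasDerivWithinAt
  · exact hτ _ l1 l2

theorem tendsto_kernel {γ : ℂ} (hγ : 0 < γ.re) {y : ℂ}
    (hy : y ∈ halfStrip γ (3 / 4 * stripRadius γ)) :
    Tendsto (fun c : ℝ => (-1) / ((c : ℂ) - 1) * kernel c y) (𝓝[≠] 1) (𝓝 (toddDeriv y)) := by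
  have hη := stripRadius_pos hγ
  have hmem : ∀ τ : ℝ, |τ - 1| < 1 / 3 → expQuot ((τ : ℂ) * y) ≠ 0 := by
    intro τ h
    obtain ⟨h1, h2⟩ := abs_lt.1 h
    refine expQuot_ne_zero hγ (halfStrip_mono γ ?_ (smul_mem_halfStrip (by linarith) hy))
    nlinarith
  have hev : ∀ᶠ c : ℝ in 𝓝[≠] 1, c ≠ 1 ∧ |c - 1| < 1 / 3 :=
    (eventually_mem_nhdsWithin).and (eventually_nhdsWithin_of_eventually_nhds (by
      have := Metric.ball_mem_nhds (1:ℝ) (show (0:ℝ) < 1/3 by norm_num)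
      filter_upwards [this] with c hc
      simpa [Real.dist_eq] using hc))
  by_cases hy0 : y = 0
  · subst hy0
    rw [toddDeriv_zero]
    refine tendsto_const_nhds.congr' ?_
    filter_upwards [hev] with c hc
    have hc' : (c : ℂ) - 1 ≠ 0 := by
      rw [sub_ne_zero]; exact_mod_cast hc.1
    rw [kernel, if_pos rfl]
    field_simp
  have h1 : expQuot y ≠ 0 := by simpa using hmem 1 (by norm_num)
  have hs := (hasDerivAt_todd h1).tendsto_slope
  have hc : Tendsto (fun c : ℝ => (c : ℂ) * y) (𝓝[≠] 1) (𝓝[≠] y) := by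
    refine tendsto_nhdsWithin_iff.2 ⟨?_, ?_⟩
    · have : Tendsto (fun c : ℝ => (c : ℂ) * y) (𝓝 1) (𝓝 (((1:ℝ):ℂ) * y)) :=
        Continuous.tendsto (by fun_prop) 1
      simp only [Complex.ofReal_one, one_mul] at this
      exact this.mono_left nhdsWithin_le_nhds
    · filter_upwards [hev] with c hc
      simp only [Set.mem_compl_iff, Set.mem_singleton_iff]
      intro h
      have h' : (c:ℂ) = 1 := mul_right_cancel₀ hy0 (by rw [h, one_mul])
      exact hc.1 (by exact_mod_cast h')
  refine (hs.comp hc).congr' ?_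
  filter_upwards [hev] with c hc
  have hc0 : c ≠ 0 := by
    have := (abs_lt.1 hc.2).1; linarith
  rw [neg_kernel_div c hc.1 hc0 hy0 h1 (hmem c hc.2), Function.comp_apply, slope_def_field]

theorem measurable_kernel (c : ℝ) : Measurable (kernel c) := by
  unfold kernel
  refine Measurable.ite (measurableSet_singleton 0) measurable_const ?_
  fun_prop

/-! ### The Hankel contour: geometry and size of the weight -/

/-- The open `η`-neighbourhood of the positive real axis. -/
def tube (η : ℝ) : Set ℂ := {t | ∃ x : ℝ, 0 ≤ x ∧ ‖t - x‖ < η}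

theorem isOpen_tube (η : ℝ) : IsOpen (tube η) := by
  have : tube η = ⋃ x : ℝ, ⋃ _ : 0 ≤ x, Metric.ball (x : ℂ) η := by
    ext t; simp [tube, dist_eq_norm]
  rw [this]
  exact isOpen_iUnion fun x => isOpen_iUnion fun _ => Metric.isOpen_ball

theorem hankelPoint_of_neg {ε u : ℝ} (hu : u < 0) : hankelPoint ε u = ((ε - u : ℝ) : ℂ) := by
  have h : u - 2 * Real.pi ≤ 0 := by linarith [Real.pi_pos]
  have h2 : min u (2 * Real.pi) ≤ 0 := (min_le_left _ _).trans hu.le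
  rw [hankelPoint, hankelRadius, hankelAngle, max_eq_left (by linarith : (0:ℝ) ≤ -u),
    max_eq_right h, max_eq_left h2]
  simp [sub_eq_add_neg]

theorem hankelRadius_of_mem {ε u : ℝ} (h0 : 0 ≤ u) (h1 : u ≤ 2 * Real.pi) :
    hankelRadius ε u = ε := by
  rw [hankelRadius, max_eq_right (by linarith), max_eq_right (by linarith)]; simp

theorem hankelAngle_of_mem {u : ℝ} (h0 : 0 ≤ u) (h1 : u ≤ 2 * Real.pi) :
    hankelAngle u = u := by
  rw [hankelAngle, min_eq_left h1, max_eq_right h0]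

theorem hankelRadius_of_neg {ε u : ℝ} (hu : u < 0) : hankelRadius ε u = ε - u := by
  rw [hankelRadius, max_eq_left (by linarith), max_eq_right (by linarith [Real.pi_pos])]; ring

theorem hankelAngle_of_neg {u : ℝ} (hu : u < 0) : hankelAngle u = 0 := by
  rw [hankelAngle, max_eq_left ((min_le_left _ _).trans hu.le)]

theorem hankelRadius_of_gt {ε u : ℝ} (hu : 2 * Real.pi < u) :
    hankelRadius ε u = ε + (u - 2 * Real.pi) := by
  rw [hankelRadius, max_eq_right (by linarith [Real.pi_pos]), max_eq_left (by linarith)]; ring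

theorem hankelAngle_of_gt {u : ℝ} (hu : 2 * Real.pi < u) : hankelAngle u = 2 * Real.pi := by
  rw [hankelAngle, min_eq_right hu.le, max_eq_right (by positivity)]

theorem hankelPoint_of_mem {ε u : ℝ} (h0 : 0 ≤ u) (h1 : u ≤ 2 * Real.pi) :
    hankelPoint ε u = ε * Complex.exp (Complex.I * u) := by
  rw [hankelPoint, hankelRadius_of_mem h0 h1, hankelAngle_of_mem h0 h1]

theorem hankelPoint_of_gt {ε u : ℝ} (hu : 2 * Real.pi < u) :
    hankelPoint ε u = ((ε + (u - 2 * Real.pi) : ℝ) : ℂ) := by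
  rw [hankelPoint, hankelRadius_of_gt hu, hankelAngle_of_gt hu]
  have : Complex.I * ((2 * Real.pi : ℝ) : ℂ) = 2 * Real.pi * Complex.I := by push_cast; ring
  rw [this, Complex.exp_two_pi_mul_I, mul_one]

theorem ofReal_mem_tube {η x : ℝ} (hη : 0 < η) (hx : 0 ≤ x) : (x : ℂ) ∈ tube η :=
  ⟨x, hx, by simpa using hη⟩

theorem mem_tube_of_norm_lt {η : ℝ} {t : ℂ} (h : ‖t‖ < η) : t ∈ tube η :=
  ⟨0, le_rfl, by simpa using h⟩

theorem norm_exp_I_mul_ofReal (u : ℝ) : ‖Complex.exp (Complex.I * u)‖ = 1 := by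
  rw [mul_comm]; exact Complex.norm_exp_ofReal_mul_I u

theorem hankelPoint_mem_tube {ε η : ℝ} (hε : 0 < ε) (h : ε < η) (u : ℝ) :
    hankelPoint ε u ∈ tube η := by
  rcases lt_or_ge u 0 with h0 | h0
  · rw [hankelPoint_of_neg h0]
    exact ofReal_mem_tube (hε.trans h) (by linarith)
  rcases le_or_gt u (2 * Real.pi) with h1 | h1
  · rw [hankelPoint_of_mem h0 h1]
    refine mem_tube_of_norm_lt ?_
    rwa [norm_mul, norm_exp_I_mul_ofReal, mul_one, Complex.norm_real, Real.norm_of_nonneg hε.le]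
  · rw [hankelPoint_of_gt h1]
    exact ofReal_mem_tube (hε.trans h) (by linarith)

/-- The density of `t^{s-1} dt` with respect to `du` on one Hankel contour. -/
noncomputable def contourWeight (ε : ℝ) (s : ℂ) (u : ℝ) : ℂ :=
  hankelPow ε u (s - 1) * hankelVelocity ε u

theorem continuous_hankelRadius (ε : ℝ) : Continuous (hankelRadius ε) := by
  unfold hankelRadius; fun_prop

theorem continuous_hankelAngle : Continuous hankelAngle := by
  unfold hankelAngle; fun_prop

theorem continuous_hankelPoint (ε : ℝ) : Continuous (hankelPoint ε) := by
  have := continuous_hankelRadius ε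
  have := continuous_hankelAngle
  unfold hankelPoint; fun_prop

theorem measurable_hankelVelocity (ε : ℝ) : Measurable (hankelVelocity ε) := by
  unfold hankelVelocity
  refine Measurable.ite measurableSet_Iio measurable_const ?_
  refine Measurable.ite measurableSet_Iic ?_ measurable_const
  fun_prop

theorem measurable_contourWeight (ε : ℝ) (s : ℂ) : Measurable (contourWeight ε s) := by
  have h1 := (continuous_hankelRadius ε).measurable
  have h2 := continuous_hankelAngle.measurable
  have h3 := measurable_hankelVelocity ε
  unfold contourWeight hankelPow
  fun_prop

theorem differentiable_contourWeight (ε u : ℝ) : Differentiable ℂ fun s => contourWeight ε s u := by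
  unfold contourWeight hankelPow
  fun_prop

theorem hankelRadius_ge {ε : ℝ} (u : ℝ) : ε ≤ hankelRadius ε u := by
  unfold hankelRadius
  linarith [le_max_right (-u) 0, le_max_right (u - 2 * Real.pi) 0]

theorem hankelRadius_le {ε : ℝ} (u : ℝ) : hankelRadius ε u ≤ ε + |u| := by
  rcases lt_or_ge u 0 with h0 | h0
  · rw [hankelRadius_of_neg h0, abs_of_neg h0]; linarith
  rcases le_or_gt u (2 * Real.pi) with h1 | h1
  · rw [hankelRadius_of_mem h0 h1]; linarith [abs_nonneg u]
  · rw [hankelRadius_of_gt h1, abs_of_nonneg h0]; linarith [Real.pi_pos]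

theorem abs_hankelAngle_le (u : ℝ) : |hankelAngle u| ≤ 2 * Real.pi := by
  rw [abs_of_nonneg (le_max_left _ _)]
  exact max_le (by positivity) (min_le_right _ _)

theorem norm_hankelVelocity_le {ε : ℝ} (hε : 0 < ε) (u : ℝ) : ‖hankelVelocity ε u‖ ≤ 1 + ε := by
  unfold hankelVelocity
  split_ifs
  · simp [hε.le]
  · rw [norm_mul, norm_exp_I_mul_ofReal, norm_mul]
    simp [abs_of_pos hε]
  · simp [hε.le]

/-- On the straight sides the point is real and equal to its radius. The constant 2π Re Γ pays for
the parameter shift on the returning side and for |u| ≤ 2π on the circle, and ε‖Γ‖ for the sign of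
the real part on the circle. -/
theorem re_hankelPoint_mul_ge {ε : ℝ} (hε : 0 < ε) {Γ : ℂ} (hΓ : 0 < Γ.re) (u : ℝ) :
    Γ.re * |u| - (ε * ‖Γ‖ + 2 * Real.pi * Γ.re) ≤ (hankelPoint ε u * Γ).re := by
  have hp : 0 < 2 * Real.pi * Γ.re := by positivity
  have hn : 0 ≤ ε * ‖Γ‖ := by positivity
  rcases lt_or_ge u 0 with h0 | h0
  · rw [hankelPoint_of_neg h0, Complex.re_ofReal_mul, abs_of_neg h0]
    nlinarith
  rcases le_or_gt u (2 * Real.pi) with h1 | h1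
  · have h2 : ‖hankelPoint ε u * Γ‖ = ε * ‖Γ‖ := by
      rw [hankelPoint_of_mem h0 h1, norm_mul, norm_mul, norm_exp_I_mul_ofReal, mul_one,
        Complex.norm_real, Real.norm_of_nonneg hε.le]
    have h3 := (abs_le.1 (Complex.abs_re_le_norm (hankelPoint ε u * Γ))).1
    rw [abs_of_nonneg h0]
    nlinarith
  · rw [hankelPoint_of_gt h1, Complex.re_ofReal_mul, abs_of_nonneg h0]
    nlinarith

/-- From log(κR) ≤ κR - 1, the logarithm of the radius grows at a linear rate κ that may be taken
arbitrarily small, so a power of t costs only e^{Mκ|u|} up to a constant. -/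
theorem norm_hankelPow_le {ε : ℝ} (hε : 0 < ε) {κ : ℝ} (hκ : 0 < κ) {a : ℂ} {M : ℝ}
    (ha : ‖a‖ ≤ M) (u : ℝ) :
    ‖hankelPow ε u a‖ ≤ Real.exp (M * (κ * (ε + |u|) + |Real.log κ| + |Real.log ε| +
      2 * Real.pi)) := by
  have hM : 0 ≤ M := (norm_nonneg _).trans ha
  rw [hankelPow, Complex.norm_exp]
  apply Real.exp_le_exp.2
  refine (Complex.re_le_norm _).trans ?_
  rw [norm_mul]
  refine mul_le_mul ha ?_ (norm_nonneg _) hM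
  refine (norm_add_le _ _).trans ?_
  have hR : 0 < hankelRadius ε u := hε.trans_le (hankelRadius_ge u)
  have h1 : Real.log (hankelRadius ε u) ≤ κ * (ε + |u|) + |Real.log κ| := by
    have h2 := Real.log_le_sub_one_of_pos (mul_pos hκ hR)
    rw [Real.log_mul hκ.ne' hR.ne'] at h2
    have h3 := mul_le_mul_of_nonneg_left (hankelRadius_le (ε := ε) u) hκ.le
    linarith [neg_abs_le (Real.log κ)]
  have h4 : Real.log ε ≤ Real.log (hankelRadius ε u) := Real.log_le_log hε (hankelRadius_ge u)
  have h5 : 0 ≤ κ * (ε + |u|) := by positivity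
  have h6 : |Real.log (hankelRadius ε u)| ≤ κ * (ε + |u|) + |Real.log κ| + |Real.log ε| := by
    rw [abs_le]
    constructor
    · linarith [neg_abs_le (Real.log ε), abs_nonneg (Real.log κ)]
    · linarith [abs_nonneg (Real.log ε)]
  have h7 := abs_hankelAngle_le u
  simp only [Complex.norm_real, Real.norm_eq_abs, norm_mul, Complex.norm_I, one_mul]
  linarith

/-- The exponential majorant beats the weight, locally uniformly in the exponent. -/
theorem exists_contourWeight_bound {ε : ℝ} (hε : 0 < ε) {Γ : ℂ} (hΓ : 0 < Γ.re) (M : ℝ) :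
    ∃ C b : ℝ, 0 < C ∧ 0 < b ∧ ∀ s : ℂ, ‖s‖ ≤ M → ∀ u : ℝ,
      Real.exp (-(hankelPoint ε u * Γ).re) * ‖contourWeight ε s u‖ ≤ C * Real.exp (-b * |u|) := by
  set N := |M| + 1 with hN
  have hN0 : 0 < N := by positivity
  -- With this κ the power uses up exactly half of the decay rate Re Γ.
  set κ := Γ.re / (2 * N) with hκ
  have hκ0 : 0 < κ := by positivity
  have hNκ : N * κ = Γ.re / 2 := by rw [hκ]; field_simp
  refine ⟨Real.exp (ε * ‖Γ‖ + 2 * Real.pi * Γ.re + Γ.re / 2 * ε +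
    N * (|Real.log κ| + |Real.log ε| + 2 * Real.pi)) * (1 + ε), Γ.re / 2,
    by positivity, by positivity, ?_⟩
  intro s hs u
  have hs1 : ‖s - 1‖ ≤ N := by
    refine (norm_sub_le _ _).trans ?_
    rw [norm_one]; linarith [le_abs_self M]
  have h1 := norm_hankelPow_le hε hκ0 hs1 u
  have h2 := re_hankelPoint_mul_ge hε hΓ u
  rw [contourWeight, norm_mul]
  calc _ ≤ Real.exp (-(Γ.re * |u| - (ε * ‖Γ‖ + 2 * Real.pi * Γ.re))) *
        (Real.exp (N * (κ * (ε + |u|) + |Real.log κ| + |Real.log ε| + 2 * Real.pi)) * (1 + ε)) := by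
        gcongr
        exact norm_hankelVelocity_le hε u
    _ = _ := by
        rw [← mul_assoc, ← Real.exp_add, mul_right_comm _ (1 + ε), ← Real.exp_add]
        congr 2
        linear_combination (ε + |u|) * hNκ

theorem integrable_exp_neg_mul_abs {b : ℝ} (hb : 0 < b) :
    Integrable fun u : ℝ => Real.exp (-b * |u|) := by
  have h1 : IntegrableOn (fun u : ℝ => Real.exp (-b * |u|)) (Set.Ioi 0) := by
    refine (integrableOn_exp_mul_Ioi (a := -b) (by linarith) 0).congr_fun ?_ measurableSet_Ioi
    intro x hx
    simp [abs_of_pos (Set.mem_Ioi.1 hx)]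
  have h2 : IntegrableOn (fun u : ℝ => Real.exp (-b * |u|)) (Set.Iic 0) := by
    refine (integrableOn_exp_mul_Iic (a := b) hb 0).congr_fun ?_ measurableSet_Iic
    intro x hx
    simp [abs_of_nonpos (Set.mem_Iic.1 hx)]
  rw [← integrableOn_univ, ← Set.Iic_union_Ioi (a := (0:ℝ))]
  exact h2.union h1

/-! ### Passage to r variables: limit and majorant of the integrand -/

theorem exists_tube_radius {r : ℕ} {γ : Fin r → ℂ} (hγ : ∀ j, 0 < (γ j).re) :
    ∃ η : ℝ, 0 < η ∧ ∀ j, ‖γ j‖ * (r * η) ≤ 3 / 4 * stripRadius (γ j) := by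
  have h : ∀ᶠ η : ℝ in 𝓝[>] 0, ∀ j, ‖γ j‖ * (r * η) ≤ 3 / 4 * stripRadius (γ j) := by
    refine Filter.eventually_all.2 fun j => ?_
    have h1 : Tendsto (fun η : ℝ => ‖γ j‖ * (r * η)) (𝓝[>] 0) (𝓝 (‖γ j‖ * (r * 0))) :=
      (Continuous.tendsto (by fun_prop) 0).mono_left nhdsWithin_le_nhds
    have h2 : ‖γ j‖ * (r * 0) < 3 / 4 * stripRadius (γ j) := by
      have := stripRadius_pos (hγ j)
      simp only [mul_zero]; positivity
    filter_upwards [h1.eventually_lt_const h2] with η h using h.le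
  obtain ⟨η, h1, h2⟩ := (h.and eventually_mem_nhdsWithin).exists
  exact ⟨η, h2, h1⟩

/-- A sum of at most r points within η of the positive real axis is within rη of it, and
multiplication by γ_j scales this error by |γ_j|. This is the constraint that fixes how small the
circles must be. -/
theorem tailArg_mem_halfStrip {r : ℕ} {γ : Fin r → ℂ} {η : ℝ} (hη : 0 < η)
    (h : ∀ j, ‖γ j‖ * (r * η) ≤ 3 / 4 * stripRadius (γ j)) {t : Fin r → ℂ}
    (ht : ∀ k, t k ∈ tube η) (j : Fin r) :
    tailArg γ t j ∈ halfStrip (γ j) (3 / 4 * stripRadius (γ j)) := by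
  choose x hx hxt using ht
  refine ⟨∑ k ∈ Finset.Ici j, x k, Finset.sum_nonneg fun k _ => hx k, ?_⟩
  rw [tailArg, Complex.ofReal_sum, ← mul_sub, ← Finset.sum_sub_distrib, norm_mul]
  refine le_trans ?_ (h j)
  gcongr
  calc _ ≤ ∑ k ∈ Finset.Ici j, η := norm_sum_le_of_le _ fun k _ => (hxt k).le
    _ ≤ ∑ k : Fin r, η := Finset.sum_le_sum_of_subset_of_nonneg (Finset.subset_univ _)
        fun _ _ _ => hη.le
    _ = r * η := by simp

/-- The limit of `(-1)^r (c - 1)^{-r} H̃_r(t; γ; c)` as `c → 1`. -/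
noncomputable def limitH {r : ℕ} (γ t : Fin r → ℂ) : ℂ := ∏ j, toddDeriv (tailArg γ t j)

/-- Both exponents are half the real part of the sum of γ_j t_k over j ≤ k, summed in the two
possible orders. -/
theorem prod_exp_tailArg {r : ℕ} (γ t : Fin r → ℂ) :
    ∏ j, Real.exp (-((tailArg γ t j).re / 2)) = majorant γ t := by
  rw [majorant, ← Real.exp_sum, ← Real.exp_sum]
  congr 1
  rw [Finset.sum_neg_distrib, Finset.sum_neg_distrib, ← Finset.sum_div, ← Complex.re_sum,
    ← Complex.re_sum]
  congr 1
  have : ∑ k, t k * ((∑ j ∈ Finset.Iic k, γ j) / 2) = ((1 / 2 : ℝ) : ℂ) * ∑ j, tailArg γ t j := by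
    simp only [tailArg, Finset.mul_sum, Finset.sum_div]
    rw [Finset.sum_comm' (t' := Finset.univ) (s' := fun j => Finset.Ici j) (by simp)]
    refine Finset.sum_congr rfl fun j _ => Finset.sum_congr rfl fun k _ => ?_
    push_cast; ring
  rw [this, Complex.re_ofReal_mul]
  ring

theorem prod_neg_kernel {r : ℕ} (γ t : Fin r → ℂ) (c : ℝ) :
    ∏ j, ((-1) / ((c : ℂ) - 1) * kernel c (tailArg γ t j)) =
      (-1) ^ r / ((c : ℂ) - 1) ^ r * tildeH γ c t := by
  rw [Finset.prod_mul_distrib, tildeH]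
  simp

theorem exists_majorant_bound {r : ℕ} {γ : Fin r → ℂ} (hγ : ∀ j, 0 < (γ j).re) {η : ℝ} (hη : 0 < η)
    (h : ∀ j, ‖γ j‖ * (r * η) ≤ 3 / 4 * stripRadius (γ j)) :
    ∃ A : ℝ, 0 < A ∧ ∀ t : Fin r → ℂ, (∀ k, t k ∈ tube η) →
      ‖limitH γ t‖ ≤ A * majorant γ t ∧
      ∀ c : ℝ, c ≠ 1 → |c - 1| < 1 / 3 →
        ‖(-1) ^ r / ((c : ℂ) - 1) ^ r * tildeH γ c t‖ ≤ A * majorant γ t := by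
  choose A hA hAb using fun j => exists_kernel_bound (hγ j)
  refine ⟨∏ j, A j, Finset.prod_pos fun j _ => hA j, fun t ht => ?_⟩
  have hm := tailArg_mem_halfStrip hη h ht
  rw [← prod_exp_tailArg, ← Finset.prod_mul_distrib]
  refine ⟨?_, fun c hc hc3 => ?_⟩
  · rw [limitH, norm_prod]
    exact Finset.prod_le_prod (fun j _ => norm_nonneg _) fun j _ => (hAb j _ (hm j)).1
  · rw [← prod_neg_kernel, norm_prod]
    exact Finset.prod_le_prod (fun j _ => norm_nonneg _) fun j _ => (hAb j _ (hm j)).2 c hc hc3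

theorem tendsto_tildeH {r : ℕ} {γ : Fin r → ℂ} (hγ : ∀ j, 0 < (γ j).re) {η : ℝ} (hη : 0 < η)
    (h : ∀ j, ‖γ j‖ * (r * η) ≤ 3 / 4 * stripRadius (γ j)) {t : Fin r → ℂ}
    (ht : ∀ k, t k ∈ tube η) :
    Tendsto (fun c : ℝ => (-1) ^ r / ((c : ℂ) - 1) ^ r * tildeH γ c t) (𝓝[≠] 1)
      (𝓝 (limitH γ t)) := by
  simp only [← prod_neg_kernel]
  exact tendsto_finsetProd _ fun j _ => tendsto_kernel (hγ j) (tailArg_mem_halfStrip hη h ht j)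

theorem differentiableAt_limitH {r : ℕ} {γ : Fin r → ℂ} (hγ : ∀ j, 0 < (γ j).re) {η : ℝ}
    (hη : 0 < η) (h : ∀ j, ‖γ j‖ * (r * η) ≤ 3 / 4 * stripRadius (γ j)) {t : Fin r → ℂ}
    (ht : ∀ k, t k ∈ tube η) : DifferentiableAt ℂ (limitH γ) t := by
  have hη' : ∀ j, 0 < stripRadius (γ j) := fun j => stripRadius_pos (hγ j)
  have h1 : ∀ j, DifferentiableAt ℂ (fun t => toddDeriv (tailArg γ t j)) t := by
    intro j
    have hle : 3 / 4 * stripRadius (γ j) ≤ stripRadius (γ j) := by linarith [hη' j]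
    have hm := halfStrip_mono (γ j) hle (tailArg_mem_halfStrip hη h ht j)
    have h2 : DifferentiableAt ℂ (fun t => tailArg γ t j) t := by
      unfold tailArg
      fun_prop
    exact (differentiableAt_toddDeriv (expQuot_ne_zero (hγ j) hm)).comp t h2
  unfold limitH
  exact (HasFDerivAt.finsetProd (u := Finset.univ)
    (g := fun j t => toddDeriv (tailArg γ t j)) fun j _ => (h1 j).hasFDerivAt).differentiableAt

theorem measurable_toddDeriv : Measurable toddDeriv := by
  have h1 := differentiable_deriv_expQuot.continuous.measurable
  have h2 := differentiable_expQuot.continuous.measurable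
  unfold toddDeriv
  fun_prop

theorem continuous_tailArg {r : ℕ} (γ : Fin r → ℂ) (j : Fin r) :
    Continuous fun t => tailArg γ t j := by
  unfold tailArg; fun_prop

theorem measurable_limitH {r : ℕ} (γ : Fin r → ℂ) : Measurable (limitH γ) := by
  unfold limitH
  exact Finset.measurable_prod _ fun j _ =>
    measurable_toddDeriv.comp (continuous_tailArg γ j).measurable

theorem measurable_tildeH {r : ℕ} (γ : Fin r → ℂ) (c : ℝ) : Measurable (tildeH γ c) := by
  unfold tildeH
  exact Finset.measurable_prod _ fun j _ =>
    (measurable_kernel c).comp (continuous_tailArg γ j).measurable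

/-! ### Products of contours and integrable domination -/

/-- The point of a product of Hankel contours of radii `ε k` with parameters `u k`. -/
noncomputable def contourPoint {r : ℕ} (ε : Fin r → ℝ) (u : Fin r → ℝ) : Fin r → ℂ :=
  fun k => hankelPoint (ε k) (u k)

/-- The density of `∏ₖ t_k^{s_k - 1} dt_k` on a product of Hankel contours. -/
noncomputable def productWeight {r : ℕ} (ε : Fin r → ℝ) (s : Fin r → ℂ) (u : Fin r → ℝ) : ℂ :=
  ∏ k, contourWeight (ε k) (s k) (u k)

theorem continuous_contourPoint {r : ℕ} (ε : Fin r → ℝ) : Continuous (contourPoint ε) :=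
  continuous_pi fun k => (continuous_hankelPoint (ε k)).comp (continuous_apply k)

theorem measurable_productWeight {r : ℕ} (ε : Fin r → ℝ) (s : Fin r → ℂ) :
    Measurable (productWeight ε s) := by
  unfold productWeight
  exact Finset.measurable_prod _ fun k _ =>
    (measurable_contourWeight (ε k) (s k)).comp (measurable_pi_apply k)

/-- Locally uniform integrable domination of the majorant times the weight. -/
theorem exists_productWeight_bound {r : ℕ} {γ : Fin r → ℂ} (hγ : ∀ j, 0 < (γ j).re)
    {ε : Fin r → ℝ} (hε : ∀ k, 0 < ε k) (M : ℝ) :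
    ∃ B : (Fin r → ℝ) → ℝ, Integrable B ∧ ∀ s : Fin r → ℂ, ‖s‖ ≤ M → ∀ u,
      majorant γ (contourPoint ε u) * ‖productWeight ε s u‖ ≤ B u := by
  have hΓ : ∀ k : Fin r, 0 < ((∑ j ∈ Finset.Iic k, γ j) / 2 : ℂ).re := by
    intro k
    have : ((∑ j ∈ Finset.Iic k, γ j) / 2 : ℂ).re = (∑ j ∈ Finset.Iic k, (γ j).re) / 2 := by
      rw [← Complex.re_sum]; simp
    rw [this]
    have := Finset.sum_pos (fun j (_ : j ∈ Finset.Iic k) => hγ j) ⟨k, by simp⟩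
    linarith
  choose C b hC hb hbound using fun k => exists_contourWeight_bound (hε k) (hΓ k) M
  refine ⟨fun u => ∏ k, (C k * Real.exp (-b k * |u k|)), ?_, ?_⟩
  · exact Integrable.fintype_prod (f := fun k x => C k * Real.exp (-b k * |x|))
      fun k => (integrable_exp_neg_mul_abs (hb k)).const_mul (C k)
  · intro s hs u
    rw [majorant, productWeight, norm_prod, ← Finset.prod_mul_distrib]
    exact Finset.prod_le_prod (fun k _ => by positivity) fun k _ =>
      hbound k (s k) ((norm_le_pi_norm s k).trans hs) (u k)

theorem continuous_majorant {r : ℕ} (γ : Fin r → ℂ) : Continuous (majorant γ) := by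
  unfold majorant
  refine continuous_finsetProd _ fun k _ => ?_
  fun_prop

theorem majorant_nonneg {r : ℕ} (γ t : Fin r → ℂ) : 0 ≤ majorant γ t :=
  Finset.prod_nonneg fun _ _ => (Real.exp_pos _).le

theorem integrable_majorant_mul {r : ℕ} {γ : Fin r → ℂ} (hγ : ∀ j, 0 < (γ j).re)
    {ε : Fin r → ℝ} (hε : ∀ k, 0 < ε k) (s : Fin r → ℂ) :
    Integrable fun u => majorant γ (contourPoint ε u) * ‖productWeight ε s u‖ := by
  obtain ⟨B, hB, hb⟩ := exists_productWeight_bound hγ hε ‖s‖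
  refine hB.mono' ?_ (ae_of_all _ fun u => ?_)
  · exact (((continuous_majorant γ).comp (continuous_contourPoint ε)).measurable.mul
      (measurable_productWeight ε s).norm).aestronglyMeasurable
  · rw [Real.norm_of_nonneg (mul_nonneg (majorant_nonneg _ _) (norm_nonneg _))]
    exact hb s le_rfl u

/-! ### Holomorphy in several variables -/

/-- Cauchy's estimate for the total derivative. -/
theorem norm_fderiv_le_of_ball {E : Type*} [NormedAddCommGroup E] [NormedSpace ℂ E] {f : E → ℂ}
    {s : E} {R C : ℝ} (hR : 0 < R) (hf : DifferentiableOn ℂ f (Metric.ball s R))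
    (hC : ∀ z ∈ Metric.ball s R, ‖f z‖ ≤ C) : ‖fderiv ℂ f s‖ ≤ 2 * C / R := by
  have hC0 : 0 ≤ C := (norm_nonneg _).trans (hC s (Metric.mem_ball_self hR))
  refine ContinuousLinearMap.opNorm_le_bound _ (by positivity) fun v => ?_
  by_cases hv : v = 0
  · simp [hv]
  have hv' : 0 < ‖v‖ := norm_pos_iff.2 hv
  -- The one-variable Cauchy estimate is applied on the complex line through s in direction v; with
  -- this ρ the disc stays within distance R/2 of s.
  set ρ := R / (2 * ‖v‖) with hρ
  have hρ0 : 0 < ρ := by positivity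
  have hmem : ∀ z : ℂ, ‖z‖ ≤ ρ → s + z • v ∈ Metric.ball s R := by
    intro z hz
    rw [Metric.mem_ball, dist_eq_norm, add_sub_cancel_left, norm_smul]
    calc ‖z‖ * ‖v‖ ≤ ρ * ‖v‖ := by gcongr
      _ = R / 2 := by rw [hρ]; field_simp
      _ < R := by linarith
  have hline : ∀ z : ℂ, ‖z‖ ≤ ρ → HasDerivAt (fun z : ℂ => f (s + z • v))
      (fderiv ℂ f (s + z • v) v) z := by
    intro z hz
    have h1 : HasFDerivAt f (fderiv ℂ f (s + z • v)) (s + z • v) :=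
      (hf.differentiableAt (Metric.isOpen_ball.mem_nhds (hmem z hz))).hasFDerivAt
    have h2 : HasDerivAt (fun z : ℂ => s + z • v) v z := by
      simpa using ((hasDerivAt_id z).smul_const v).const_add s
    exact h1.comp_hasDerivAt z h2
  have hd : DiffContOnCl ℂ (fun z : ℂ => f (s + z • v)) (Metric.ball 0 ρ) := by
    refine DifferentiableOn.diffContOnCl_ball (U := Metric.closedBall 0 ρ) ?_ le_rfl
    intro z hz
    exact (hline z (by simpa using hz)).differentiableAt.differentiableWithinAt
  have key := Complex.norm_deriv_le_of_forall_mem_sphere_norm_le hρ0 hd (C := C) (by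
    intro z hz
    exact hC _ (hmem z (by simpa using (mem_sphere_iff_norm.1 hz).le)))
  have h0 := (hline 0 (by simpa using hρ0.le)).deriv
  rw [zero_smul, add_zero] at h0
  rw [h0] at key
  refine key.trans (le_of_eq ?_)
  rw [hρ]; field_simp

/-- A locally dominated integral of holomorphic functions of several variables is holomorphic. -/
theorem differentiableAt_integral_of_dominated {ι α : Type*} [Fintype ι] [MeasurableSpace α]
    {μ : Measure α} {H : (ι → ℂ) → α → ℂ} {s₀ : ι → ℂ} {R : ℝ} (hR : 0 < R) {B : α → ℝ}
    (hmeas : ∀ s ∈ Metric.ball s₀ R, AEStronglyMeasurable (H s) μ)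
    (hdiff : ∀ a, DifferentiableOn ℂ (fun s => H s a) (Metric.ball s₀ R))
    (hB : Integrable B μ) (hb : ∀ᵐ a ∂μ, ∀ s ∈ Metric.ball s₀ R, ‖H s a‖ ≤ B a) :
    DifferentiableAt ℂ (fun s => ∫ a, H s a ∂μ) s₀ := by
  classical
  have hs₀ : s₀ ∈ Metric.ball s₀ R := Metric.mem_ball_self hR
  have hat : ∀ a, ∀ s ∈ Metric.ball s₀ R, DifferentiableAt ℂ (fun s => H s a) s := fun a s hs =>
    (hdiff a).differentiableAt (Metric.isOpen_ball.mem_nhds hs)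
  have hsub : Metric.ball s₀ (R / 2) ⊆ Metric.ball s₀ R := Metric.ball_subset_ball (by linarith)
  refine (hasFDerivAt_integral_of_dominated_of_fderiv_le (𝕜 := ℂ)
    (F' := fun s a => fderiv ℂ (fun s => H s a) s) (bound := fun a => 2 * B a / (R / 2))
    (Metric.ball_mem_nhds s₀ (half_pos hR)) ?_ ?_ ?_ ?_ ?_ ?_).differentiableAt
  · filter_upwards [Metric.ball_mem_nhds s₀ hR] with s hs using hmeas s hs
  · exact hB.mono' (hmeas s₀ hs₀) (hb.mono fun a ha => ha s₀ hs₀)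
  -- Measurability of the derivative in the parameter: each partial derivative is a pointwise limit
  -- of difference quotients along a null sequence, and the total derivative is a finite combination
  -- of partial derivatives.
  · have hpart : ∀ i, AEStronglyMeasurable
        (fun a => fderiv ℂ (fun s => H s a) s₀ (Pi.single i 1)) μ := by
      intro i
      set t : ℕ → ℂ := fun n => ((R / 2 / (n + 1 : ℝ) : ℝ) : ℂ) with ht
      have htn : ∀ n, ‖t n‖ < R := by
        intro n
        rw [ht, Complex.norm_real, Real.norm_of_nonneg (by positivity)]
        calc R / 2 / (n + 1 : ℝ) ≤ R / 2 := div_le_self (by positivity) (by linarith [n.cast_nonneg (α := ℝ)])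
          _ < R := by linarith
      have ht0 : Tendsto t atTop (𝓝[≠] 0) := by
        refine tendsto_nhdsWithin_iff.2 ⟨?_, Eventually.of_forall fun n => ?_⟩
        · have h1 : Tendsto (fun n : ℕ => R / 2 / (n + 1 : ℝ)) atTop (𝓝 0) := by
            have := (tendsto_one_div_add_atTop_nhds_zero_nat (𝕜 := ℝ)).const_mul (R / 2)
            simpa [div_eq_mul_inv] using this
          have h2 := (Complex.continuous_ofReal.tendsto 0).comp h1
          simpa [ht, Function.comp_def] using h2
        · have : R / 2 / (n + 1 : ℝ) ≠ 0 := by positivity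
          exact Complex.ofReal_ne_zero.2 this
      refine aestronglyMeasurable_of_tendsto_ae (f := fun n a => (t n)⁻¹ •
        (H (s₀ + t n • Pi.single i 1) a - H s₀ a)) atTop (fun n => ?_) (ae_of_all _ fun a => ?_)
      · refine AEStronglyMeasurable.fun_const_smul (f := fun a => H _ a - H s₀ a)
          ((hmeas _ ?_).sub (hmeas _ hs₀)) _
        rw [Metric.mem_ball, dist_eq_norm, add_sub_cancel_left, norm_smul]
        simpa [Pi.norm_single] using htn n
      · have h1 : HasDerivAt (fun z : ℂ => H (s₀ + z • Pi.single i 1) a)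
            (fderiv ℂ (fun s => H s a) s₀ (Pi.single i 1)) 0 := by
          have h2 : HasDerivAt (fun z : ℂ => s₀ + z • (Pi.single i 1 : ι → ℂ)) (Pi.single i 1) 0 := by
            simpa using ((hasDerivAt_id (0 : ℂ)).smul_const (Pi.single i 1 : ι → ℂ)).const_add s₀
          have h3 : HasFDerivAt (fun s => H s a) (fderiv ℂ (fun s => H s a) s₀)
              (s₀ + (0 : ℂ) • Pi.single i 1) := by
            simpa using (hat a s₀ hs₀).hasFDerivAt
          exact h3.comp_hasDerivAt (0 : ℂ) h2
        have h4 := h1.tendsto_slope_zero.comp ht0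
        simpa [Function.comp_def] using h4
    have hsum : (fun a => fderiv ℂ (fun s => H s a) s₀) = fun a =>
        ∑ i, fderiv ℂ (fun s => H s a) s₀ (Pi.single i 1) •
          (ContinuousLinearMap.proj i : (ι → ℂ) →L[ℂ] ℂ) := by
      funext a
      ext v
      conv_lhs => rw [pi_eq_sum_univ' v]
      rw [map_sum]
      simp only [map_smul, _root_.sum_apply, _root_.smul_apply,
        ContinuousLinearMap.proj_apply, smul_eq_mul]
      refine Finset.sum_congr rfl fun i _ => ?_
      rw [mul_comm]
    show AEStronglyMeasurable (fun a => fderiv ℂ (fun s => H s a) s₀) μ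
    rw [hsum]
    exact Finset.aestronglyMeasurable_fun_sum _ fun i _ => (hpart i).smul_const _
  · filter_upwards [hb] with a ha s hs
    have hs' : Metric.ball s (R / 2) ⊆ Metric.ball s₀ R := by
      refine Metric.ball_subset_ball' ?_
      linarith [Metric.mem_ball.1 hs]
    exact norm_fderiv_le_of_ball (half_pos hR) ((hdiff a).mono hs') fun z hz => ha z (hs' hz)
  · exact (hB.const_mul 2).div_const _
  · exact ae_of_all _ fun a s hs => (hat a s (hsub hs)).hasFDerivAt

/-- The difference quotient of an entire function in one of its variables is entire. -/
theorem differentiable_dslope_update {ι : Type*} [Fintype ι] [DecidableEq ι] {f : (ι → ℂ) → ℂ}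
    (hf : Differentiable ℂ f) (k : ι) (n : ℂ) :
    Differentiable ℂ fun s : ι → ℂ => dslope (fun ζ => f (Function.update s k ζ)) n (s k) := by
  intro s₀
  have hcont : Continuous f := hf.continuous
  have hupd : ∀ s : ι → ℂ, Differentiable ℂ fun ζ => f (Function.update s k ζ) := fun s =>
    hf.comp fun ζ => (hasFDerivAt_update s ζ).differentiableAt
  -- For s within distance 1 of s₀, the point s_k stays inside the circle of radius ρ about n, at
  -- distance at least 1 from it. Cauchy's formula over this circle then represents the difference
  -- quotient at s_k. On the circle itself ζ ≠ n, so the quotient is an honest one and the integrand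
  -- depends holomorphically on s.
  set ρ := ‖s₀ k - n‖ + 2 with hρ
  have hρ0 : 0 < ρ := by positivity
  set H : (ι → ℂ) → ℝ → ℂ := fun s θ => deriv (circleMap n ρ) θ *
    ((circleMap n ρ θ - s k)⁻¹ * ((f (Function.update s k (circleMap n ρ θ)) -
      f (Function.update s k n)) / (circleMap n ρ θ - n))) with hH
  have hball : ∀ s ∈ Metric.closedBall s₀ 1, ‖s k - n‖ ≤ ρ - 1 := by
    intro s hs
    have h1 : ‖s k - s₀ k‖ ≤ 1 := by
      have := (norm_le_pi_norm (s - s₀) k).trans (mem_closedBall_iff_norm.1 hs)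
      simpa using this
    have h2 := norm_add_le (s k - s₀ k) (s₀ k - n)
    rw [sub_add_sub_cancel] at h2
    linarith
  have hne : ∀ θ, circleMap n ρ θ - n ≠ 0 := fun θ => by
    rw [sub_ne_zero]; exact circleMap_ne_center hρ0.ne'
  have hne' : ∀ s ∈ Metric.closedBall s₀ 1, ∀ θ, circleMap n ρ θ - s k ≠ 0 := by
    intro s hs θ h
    have h1 : circleMap n ρ θ - n = s k - n := by linear_combination h
    have h2 : ‖circleMap n ρ θ - n‖ = ρ := by
      simp [circleMap_sub_center, abs_of_pos hρ0]
    rw [h1] at h2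
    linarith [hball s hs]
  have hcontH : ContinuousOn (fun p : (ι → ℂ) × ℝ => H p.1 p.2)
      (Metric.closedBall s₀ 1 ×ˢ Set.Icc 0 (2 * Real.pi)) := by
    have hc : Continuous fun p : (ι → ℂ) × ℝ => circleMap n ρ p.2 :=
      (continuous_circleMap n ρ).comp continuous_snd
    have hu1 : Continuous fun p : (ι → ℂ) × ℝ => f (Function.update p.1 k (circleMap n ρ p.2)) :=
      hcont.comp (continuous_fst.update k hc)
    have hu2 : Continuous fun p : (ι → ℂ) × ℝ => f (Function.update p.1 k n) :=
      hcont.comp (continuous_fst.update k continuous_const)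
    simp only [hH, deriv_circleMap]
    refine ContinuousOn.mul ?_ (ContinuousOn.mul (ContinuousOn.inv₀ ?_ ?_) (ContinuousOn.div ?_ ?_ ?_))
    · have : Continuous fun p : (ι → ℂ) × ℝ => circleMap 0 ρ p.2 :=
        (continuous_circleMap 0 ρ).comp continuous_snd
      fun_prop
    · fun_prop
    · exact fun p hp => hne' p.1 hp.1 p.2
    · fun_prop
    · fun_prop
    · exact fun p _ => hne p.2
  obtain ⟨C, hC⟩ := ((isCompact_closedBall s₀ 1).prod isCompact_Icc).exists_bound_of_continuousOn
    hcontH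
  have hint : DifferentiableAt ℂ
      (fun s => ∫ θ, H s θ ∂(volume.restrict (Set.Ioc 0 (2 * Real.pi)))) s₀ := by
    refine differentiableAt_integral_of_dominated (B := fun _ => C) one_pos ?_ ?_ ?_ ?_
    · intro s hs
      refine ContinuousOn.aestronglyMeasurable ?_ measurableSet_Ioc
      exact hcontH.comp (f := fun θ : ℝ => (s, θ)) (by fun_prop)
        fun θ hθ => ⟨Metric.ball_subset_closedBall hs, Set.Ioc_subset_Icc_self hθ⟩
    · intro θ s hs
      refine DifferentiableAt.differentiableWithinAt ?_
      have hu : ∀ z : ℂ, DifferentiableAt ℂ (fun s : ι → ℂ => f (Function.update s k z)) s := by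
        intro z
        refine (hf _).comp s (differentiableAt_pi.2 fun i => ?_)
        by_cases hi : i = k
        · subst hi; simp
        · simp only [Function.update_of_ne hi]; fun_prop
      have h1 := hne' s (Metric.ball_subset_closedBall hs) θ
      have h2 : DifferentiableAt ℂ (fun s : ι → ℂ => (circleMap n ρ θ - s k)⁻¹) s :=
        DifferentiableAt.inv (by fun_prop) h1
      simp only [hH]
      simp only [div_eq_mul_inv]
      exact (h2.mul (((hu _).sub (hu _)).mul_const _)).const_mul _
    · exact integrable_const C
    · refine ae_restrict_of_forall_mem measurableSet_Ioc fun θ hθ s hs => ?_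
      exact hC (s, θ) ⟨Metric.ball_subset_closedBall hs, Set.Ioc_subset_Icc_self hθ⟩
  refine ((hint.const_smul (2 * Real.pi * Complex.I : ℂ)⁻¹)).congr_of_eventuallyEq ?_
  filter_upwards [Metric.ball_mem_nhds s₀ one_pos] with s hs
  have hd : DifferentiableOn ℂ (dslope (fun ζ => f (Function.update s k ζ)) n) Set.univ :=
    (Complex.differentiableOn_dslope univ_mem).2 (hupd s).differentiableOn
  have hcl : DiffContOnCl ℂ (dslope (fun ζ => f (Function.update s k ζ)) n) (Metric.ball n ρ) :=
    (differentiableOn_univ.1 hd).diffContOnCl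
  have hw : s k ∈ Metric.ball n ρ := by
    rw [mem_ball_iff_norm]
    linarith [hball s (Metric.ball_subset_closedBall hs)]
  have key := hcl.two_pi_i_inv_smul_circleIntegral_sub_inv_smul hw
  rw [← key, circleIntegral, intervalIntegral.integral_of_le (by positivity)]
  simp only [Pi.smul_apply]
  congr 1
  refine integral_congr_ae (ae_of_all _ fun θ => ?_)
  simp only [hH, smul_eq_mul]
  rw [dslope_of_ne _ (by rw [← sub_ne_zero]; exact hne θ), slope_def_field]

/-! ### The factor 1/((e^{2πis} - 1)Γ(s)) and cancellation of its poles -/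

/-- The function `e^{2πiz} - 1`. -/
noncomputable def expPeriod (z : ℂ) : ℂ := Complex.exp (2 * Real.pi * Complex.I * z) - 1

theorem hasDerivAt_expPeriod (z : ℂ) : HasDerivAt expPeriod
    (2 * Real.pi * Complex.I * Complex.exp (2 * Real.pi * Complex.I * z)) z := by
  have h := ((hasDerivAt_id z).const_mul (2 * Real.pi * Complex.I : ℂ)).cexp.sub_const 1
  simp only [id, mul_one] at h
  rw [mul_comm]
  exact h

theorem expPeriod_eq_zero_iff {z : ℂ} : expPeriod z = 0 ↔ ∃ n : ℤ, z = n := by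
  have hpi : (2 * Real.pi * Complex.I : ℂ) ≠ 0 := Complex.two_pi_I_ne_zero
  rw [expPeriod, sub_eq_zero, Complex.exp_eq_one_iff]
  refine exists_congr fun n => ?_
  rw [mul_comm (n : ℂ)]
  exact mul_right_inj' hpi

theorem exp_two_pi_I_mul_int (n : ℤ) : Complex.exp (2 * Real.pi * Complex.I * n) = 1 :=
  sub_eq_zero.1 (expPeriod_eq_zero_iff.2 ⟨n, rfl⟩)

/-- The default value 0 of `Complex.Gamma` at its poles makes the inverse agree there with the
entire function 1/Γ. -/
theorem inv_Gamma_neg_nat (m : ℕ) : (Complex.Gamma (-(m : ℂ)))⁻¹ = 0 := by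
  rw [Complex.Gamma_neg_nat_eq_zero, inv_zero]

/-- At -m both 1/Γ and e^{2πiz} - 1 vanish, so their quotient is a quotient of slopes; the second
slope tends to 2πi ≠ 0. -/
theorem hankelFactor_neg_nat (m : ℕ) : hankelFactor (-(m : ℂ)) =
    deriv (fun z => (Complex.Gamma z)⁻¹) (-(m : ℂ)) / (2 * Real.pi * Complex.I) := by
  rw [hankelFactor, if_pos ⟨m, rfl⟩]
  refine Tendsto.limUnder_eq ?_
  have h1 := (Complex.differentiable_one_div_Gamma (-(m : ℂ))).hasDerivAt.tendsto_slope
  have h2 := (hasDerivAt_expPeriod (-(m : ℂ))).tendsto_slope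
  have h0 : expPeriod (-(m : ℂ)) = 0 := expPeriod_eq_zero_iff.2 ⟨-m, by simp⟩
  have hone : Complex.exp (2 * Real.pi * Complex.I * (-(m : ℂ))) = 1 := sub_eq_zero.1 h0
  rw [hone, mul_one] at h2
  refine (h1.div h2 Complex.two_pi_I_ne_zero).congr' ?_
  filter_upwards [self_mem_nhdsWithin] with z hz
  have hz' : z - -(m : ℂ) ≠ 0 := sub_ne_zero.2 hz
  rw [Pi.div_apply, slope_def_field, slope_def_field, h0, inv_Gamma_neg_nat, sub_zero, sub_zero,
    div_div_div_cancel_right₀ hz', expPeriod]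
  rw [one_div, mul_inv, div_eq_mul_inv, mul_comm]

theorem hankelFactor_of_ne {z : ℂ} (hz : ∀ m : ℕ, z ≠ -(m : ℂ)) :
    hankelFactor z = (Complex.Gamma z)⁻¹ / expPeriod z := by
  rw [hankelFactor, if_neg (by push Not; exact hz), expPeriod, one_div, mul_inv, div_eq_mul_inv,
    mul_comm]

/-- The factor `1/((e^{2πis_k} - 1)Γ(s_k))` times an entire function that vanishes at its poles
extends to an entire function. -/
theorem exists_differentiable_hankelFactor_mul {ι : Type*} [Fintype ι] [DecidableEq ι]
    {b : (ι → ℂ) → ℂ} (hb : Differentiable ℂ b) (k : ι)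
    (hzero : ∀ s : ι → ℂ, ∀ m : ℕ, s k = m + 1 → b s = 0) :
    ∃ F : (ι → ℂ) → ℂ, Differentiable ℂ F ∧
      ∀ s : ι → ℂ, (∀ m : ℕ, s k ≠ m + 1) → F s = hankelFactor (s k) * b s := by
  classical
  set f : (ι → ℂ) → ℂ := fun s => (Complex.Gamma (s k))⁻¹ * b s with hf
  have hfd : Differentiable ℂ f := by
    have : Differentiable ℂ fun s : ι → ℂ => (Complex.Gamma (s k))⁻¹ :=
      Complex.differentiable_one_div_Gamma.comp (g := fun z => (Complex.Gamma z)⁻¹)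
        (f := fun s : ι → ℂ => s k) (by fun_prop)
    exact this.mul hb
  have hf0 : ∀ s : ι → ℂ, ∀ n : ℤ, s k = n → f s = 0 := by
    intro s n hn
    rcases lt_or_ge 0 n with h | h
    · obtain ⟨m, rfl⟩ : ∃ m : ℕ, n = m + 1 := ⟨(n - 1).toNat, by omega⟩
      simp only [hf]
      rw [hzero s m (by rw [hn]; push_cast; rfl), mul_zero]
    · obtain ⟨m, rfl⟩ : ∃ m : ℕ, n = -m := ⟨(-n).toNat, by omega⟩
      simp only [hf]
      rw [hn, Int.cast_neg, Int.cast_natCast, inv_Gamma_neg_nat, zero_mul]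
  -- b/Γ(s_k) vanishes at every integer s_k: at n ≥ 1 because of b, at n ≤ 0 because of 1/Γ.
  -- Division by the simple zeros of e^{2πis_k} - 1 thus leaves l'Hôpital's value.
  set F : (ι → ℂ) → ℂ := fun s => if expPeriod (s k) = 0 then
    deriv (fun ζ => f (Function.update s k ζ)) (s k) / (2 * Real.pi * Complex.I)
    else f s / expPeriod (s k) with hF
  have hper : Differentiable ℂ expPeriod := fun z => (hasDerivAt_expPeriod z).differentiableAt
  have hperk : Differentiable ℂ fun s : ι → ℂ => expPeriod (s k) :=
    hper.comp (f := fun s : ι → ℂ => s k) (by fun_prop)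
  refine ⟨F, ?_, ?_⟩
  · intro s₀
    by_cases h : expPeriod (s₀ k) = 0
    · obtain ⟨n, hn⟩ := expPeriod_eq_zero_iff.1 h
      set ψ := dslope expPeriod (n : ℂ) with hψ
      have hψd : Differentiable ℂ ψ := differentiableOn_univ.1
        ((Complex.differentiableOn_dslope univ_mem).2 hper.differentiableOn)
      have hψn : ψ n = 2 * Real.pi * Complex.I := by
        rw [hψ, dslope_same, (hasDerivAt_expPeriod _).deriv, exp_two_pi_I_mul_int, mul_one]
      have hψk : Differentiable ℂ fun s : ι → ℂ => ψ (s k) :=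
        hψd.comp (f := fun s : ι → ℂ => s k) (by fun_prop)
      have hψ0 : ψ (s₀ k) ≠ 0 := by
        rw [hn, hψn]; exact Complex.two_pi_I_ne_zero
      -- Near s_k = n, F is the quotient of the two divided differences at n, whose denominator is
      -- close to 2πi.
      refine ((differentiable_dslope_update hfd k n s₀).mul ((hψk s₀).inv hψ0)).congr_of_eventuallyEq ?_
      filter_upwards [hψk.continuous.continuousAt.eventually_ne hψ0] with s hs
      have e1 : (s k - n) * ψ (s k) = expPeriod (s k) := by
        have := sub_smul_dslope expPeriod (n : ℂ) (s k)
        rw [smul_eq_mul, (expPeriod_eq_zero_iff (z := (n : ℂ))).2 ⟨n, rfl⟩, sub_zero] at this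
        exact this
      simp only [hF, Pi.mul_apply, Pi.inv_apply, ← div_eq_mul_inv]
      by_cases hsn : s k = n
      · rw [if_pos (expPeriod_eq_zero_iff.2 ⟨n, hsn⟩)]
        rw [hsn, dslope_same, hψn]
      · have hsn' : s k - n ≠ 0 := sub_ne_zero.2 hsn
        rw [if_neg (by rw [← e1]; exact mul_ne_zero hsn' hs), dslope_of_ne _ hsn, slope_def_field,
          Function.update_eq_self, hf0 (Function.update s k n) n (by simp), sub_zero, ← e1,
          div_div]
    · refine ((hfd s₀).mul ((hperk s₀).inv h)).congr_of_eventuallyEq ?_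
      filter_upwards [hperk.continuous.continuousAt.eventually_ne h] with s hs
      simp only [hF, Pi.mul_apply, Pi.inv_apply, ← div_eq_mul_inv]
      rw [if_neg hs]
  · intro s hs
    simp only [hF]
    split_ifs with h
    · obtain ⟨n, hn⟩ := expPeriod_eq_zero_iff.1 h
      obtain ⟨m, rfl⟩ : ∃ m : ℕ, n = -m := by
        rcases lt_or_ge 0 n with h | h
        · exfalso
          refine hs (n - 1).toNat ?_
          rw [hn]
          have : (((n - 1).toNat : ℤ) : ℂ) = ((n - 1 : ℤ) : ℂ) := by
            rw [Int.toNat_of_nonneg (by omega)]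
          rw [Int.cast_natCast] at this
          rw [this]; push_cast; ring
        · exact ⟨(-n).toNat, by omega⟩
      have hn' : s k = -(m : ℂ) := by rw [hn]; push_cast; rfl
      have hbd : DifferentiableAt ℂ (fun ζ => b (Function.update s k ζ)) (s k) :=
        (hb _).comp (s k) (hasFDerivAt_update s (s k)).differentiableAt
      have hd := ((Complex.differentiable_one_div_Gamma (s k)).hasDerivAt.mul hbd.hasDerivAt).deriv
      have he : (fun ζ => f (Function.update s k ζ)) =
          (fun z => (Complex.Gamma z)⁻¹) * fun ζ => b (Function.update s k ζ) := by
        funext ζ; simp [hf]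
      rw [he, hd, Function.update_eq_self, hn', inv_Gamma_neg_nat, hankelFactor_neg_nat]
      ring
    · rw [hankelFactor_of_ne]
      · simp only [hf]; ring
      · intro m hm
        exact h (expPeriod_eq_zero_iff.2 ⟨-m, by rw [hm]; simp⟩)

/-! ### One-variable Hankel integrals -/

/-- The integrand `g(t) t^{s-1}` on the top side of the positive real axis. -/
noncomputable def rayIntegrand (g : ℂ → ℂ) (s : ℂ) (x : ℝ) : ℂ :=
  g x * Complex.exp ((s - 1) * (Real.log x : ℂ))

/-- The integral of `g(t) t^{s-1} dt` over one Hankel contour. -/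
noncomputable def contourIntegral (ε : ℝ) (g : ℂ → ℂ) (s : ℂ) : ℂ :=
  ∫ u : ℝ, g (hankelPoint ε u) * contourWeight ε s u

/-- The integral of `g(t) t^{s-1} dt` over the circle of radius `ε`. -/
noncomputable def circlePart (ε : ℝ) (g : ℂ → ℂ) (s : ℂ) : ℂ :=
  ∫ u in (0 : ℝ)..2 * Real.pi, g (ε * Complex.exp (Complex.I * u)) *
    (Complex.exp ((s - 1) * ((Real.log ε : ℂ) + Complex.I * u)) *
      (Complex.I * ε * Complex.exp (Complex.I * u)))

theorem contourWeight_of_neg {ε u : ℝ} (s : ℂ) (hu : u < 0) :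
    contourWeight ε s u = -Complex.exp ((s - 1) * (Real.log (ε - u) : ℂ)) := by
  rw [contourWeight, hankelPow, hankelRadius_of_neg hu, hankelAngle_of_neg hu, hankelVelocity,
    if_pos hu]
  simp

theorem contourWeight_of_mem {ε u : ℝ} (s : ℂ) (h0 : 0 ≤ u) (h1 : u ≤ 2 * Real.pi) :
    contourWeight ε s u = Complex.exp ((s - 1) * ((Real.log ε : ℂ) + Complex.I * u)) *
      (Complex.I * ε * Complex.exp (Complex.I * u)) := by
  rw [contourWeight, hankelPow, hankelRadius_of_mem h0 h1, hankelAngle_of_mem h0 h1,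
    hankelVelocity, if_neg h0.not_gt, if_pos h1]

theorem contourWeight_of_gt {ε u : ℝ} (s : ℂ) (hu : 2 * Real.pi < u) :
    contourWeight ε s u = Complex.exp (2 * Real.pi * Complex.I * s) *
      Complex.exp ((s - 1) * (Real.log (ε + (u - 2 * Real.pi)) : ℂ)) := by
  have h0 : ¬ u < 0 := by linarith [Real.pi_pos]
  rw [contourWeight, hankelPow, hankelRadius_of_gt hu, hankelAngle_of_gt hu, hankelVelocity,
    if_neg h0, if_neg hu.not_ge, mul_one, ← Complex.exp_add]
  have : (s - 1) * ((Real.log (ε + (u - 2 * Real.pi)) : ℂ) +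
      Complex.I * ((2 * Real.pi : ℝ) : ℂ)) = (2 * Real.pi * Complex.I * s +
      (s - 1) * (Real.log (ε + (u - 2 * Real.pi)) : ℂ)) - 2 * Real.pi * Complex.I := by
    push_cast; ring
  rw [this, Complex.exp_periodic.sub_eq]

theorem integrableOn_rayIntegrand {ε : ℝ} {g : ℂ → ℂ} {s : ℂ}
    (h : Integrable fun u : ℝ => g (hankelPoint ε u) * contourWeight ε s u) :
    IntegrableOn (rayIntegrand g s) (Set.Ioi ε) := by
  have h1 : IntegrableOn (fun u : ℝ => rayIntegrand g s (ε - u)) (Set.Iio 0) := by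
    refine (h.neg.integrableOn (s := Set.Iio 0)).congr_fun ?_ measurableSet_Iio
    intro u hu
    simp only [Pi.neg_apply]
    rw [contourWeight_of_neg s hu, hankelPoint_of_neg hu, rayIntegrand]
    ring
  rw [← integrable_indicator_iff measurableSet_Iio] at h1
  rw [← integrable_indicator_iff measurableSet_Ioi, ← integrable_comp_sub_left _ ε]
  refine h1.congr (ae_of_all _ fun u => ?_)
  simp only [Set.indicator_apply, Set.mem_Iio, Set.mem_Ioi, lt_sub_iff_add_lt, add_lt_iff_neg_left]

/-- The incoming side contributes minus the ray integral because of its orientation, the outgoing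
side e^{2πi(s-1)} = e^{2πis} times it. -/
theorem contourIntegral_eq {ε : ℝ} {g : ℂ → ℂ} {s : ℂ}
    (h : Integrable fun u : ℝ => g (hankelPoint ε u) * contourWeight ε s u) :
    contourIntegral ε g s = expPeriod s * (∫ x in Set.Ioi ε, rayIntegrand g s x) +
      circlePart ε g s := by
  have hpi : (0 : ℝ) ≤ 2 * Real.pi := by positivity
  have hneg : ∫ u in Set.Iio (0:ℝ), g (hankelPoint ε u) * contourWeight ε s u =
      -∫ x in Set.Ioi ε, rayIntegrand g s x := by
    rw [← integral_indicator measurableSet_Iio, ← integral_indicator measurableSet_Ioi,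
      ← integral_sub_left_eq_self (Set.indicator (Set.Ioi ε) _) volume ε, ← integral_neg]
    congr 1
    funext u
    by_cases hu : u < 0
    · rw [Set.indicator_of_mem (Set.mem_Iio.2 hu),
        Set.indicator_of_mem (show ε - u ∈ Set.Ioi ε by rw [Set.mem_Ioi]; linarith),
        contourWeight_of_neg s hu, hankelPoint_of_neg hu, rayIntegrand]
      ring
    · rw [Set.indicator_of_notMem (by simpa using hu), Set.indicator_of_notMem (by simpa using hu),
        neg_zero]
  have hpos : ∫ u in Set.Ioi (2 * Real.pi), g (hankelPoint ε u) * contourWeight ε s u =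
      Complex.exp (2 * Real.pi * Complex.I * s) * ∫ x in Set.Ioi ε, rayIntegrand g s x := by
    rw [← integral_const_mul, ← integral_indicator measurableSet_Ioi,
      ← integral_indicator measurableSet_Ioi,
      ← integral_sub_right_eq_self (Set.indicator (Set.Ioi ε) _) (μ := volume) (2 * Real.pi - ε)]
    congr 1
    funext u
    have e : u - (2 * Real.pi - ε) = ε + (u - 2 * Real.pi) := by ring
    rw [e]
    by_cases hu : 2 * Real.pi < u
    · rw [Set.indicator_of_mem (Set.mem_Ioi.2 hu), Set.indicator_of_mem (by simpa using hu),
        contourWeight_of_gt s hu, hankelPoint_of_gt hu, rayIntegrand]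
      ring
    · rw [Set.indicator_of_notMem (by simpa using hu), Set.indicator_of_notMem (by simpa using hu)]
  have hmid : ∫ u in Set.Icc (0:ℝ) (2 * Real.pi), g (hankelPoint ε u) * contourWeight ε s u =
      circlePart ε g s := by
    rw [circlePart, intervalIntegral.integral_of_le hpi, ← integral_Icc_eq_integral_Ioc]
    refine setIntegral_congr_fun measurableSet_Icc fun u hu => ?_
    rw [contourWeight_of_mem s hu.1 hu.2, hankelPoint_of_mem hu.1 hu.2]
  have hu1 : Set.Iio (0:ℝ) ∪ (Set.Icc 0 (2 * Real.pi) ∪ Set.Ioi (2 * Real.pi)) = Set.univ := by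
    rw [Set.Icc_union_Ioi_eq_Ici hpi, Set.Iio_union_Ici]
  rw [contourIntegral, ← setIntegral_univ, ← hu1, setIntegral_union ?_ ?_ h.integrableOn
    h.integrableOn, setIntegral_union ?_ measurableSet_Ioi h.integrableOn h.integrableOn, hneg,
    hpos, hmid, expPeriod]
  · ring
  · rw [Set.disjoint_left]; rintro x hx hx'
    exact absurd hx.2 (not_le.2 hx')
  · rw [Set.Icc_union_Ioi_eq_Ici hpi, Set.disjoint_left]; rintro x hx hx'
    exact absurd (Set.mem_Iio.1 hx) (not_lt.2 hx')
  · exact measurableSet_Icc.union measurableSet_Ioi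

/-- At positive integers the Hankel integral of a holomorphic function vanishes. -/
theorem contourIntegral_nat_add_one {ε η : ℝ} (hε : 0 < ε) (hεη : ε < η) {g : ℂ → ℂ}
    (hg : DifferentiableOn ℂ g (tube η)) (m : ℕ)
    (h : Integrable fun u : ℝ => g (hankelPoint ε u) * contourWeight ε (m + 1) u) :
    contourIntegral ε g (m + 1) = 0 := by
  -- At a positive integer the two sides cancel. On the circle the integrand is the single-valued
  -- holomorphic function g(z) z^m, and Cauchy's theorem applies.
  rw [contourIntegral_eq h, expPeriod_eq_zero_iff.2 ⟨m + 1, by push_cast; rfl⟩, zero_mul, zero_add]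
  have hd : DiffContOnCl ℂ (fun z => g z * z ^ m) (Metric.ball 0 ε) := by
    refine DifferentiableOn.diffContOnCl_ball (U := Metric.closedBall 0 ε) ?_ le_rfl
    refine DifferentiableOn.mul (hg.mono fun z hz => ?_) (by fun_prop)
    exact mem_tube_of_norm_lt ((mem_closedBall_zero_iff.1 hz).trans_lt hεη)
  have key := hd.circleIntegral_eq_zero hε.le
  rw [circleIntegral] at key
  rw [circlePart, ← key]
  congr 1
  funext u
  have e1 : circleMap 0 ε u = ε * Complex.exp (Complex.I * u) := by
    rw [circleMap, zero_add, mul_comm Complex.I]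
  have e2 : Complex.exp (((m : ℂ) + 1 - 1) * ((Real.log ε : ℂ) + Complex.I * u)) =
      (ε * Complex.exp (Complex.I * u)) ^ m := by
    rw [add_sub_cancel_right, Complex.exp_nat_mul, Complex.exp_add, ← Complex.ofReal_exp,
      Real.exp_log hε]
  rw [deriv_circleMap, e1, e2, smul_eq_mul]
  ring

/-- The substitution t = e^z unrolls the slit annulus into the rectangle [log ε, log ε'] × [0, 2π]
and makes t^{s-1} dt the single-valued e^{sz} dz. Cauchy's theorem for the rectangle compares the
two circles with the pieces of ray between them. -/
theorem contourIntegral_eq_of_lt {ε ε' η : ℝ} (hε : 0 < ε) (hlt : ε < ε') (hεη : ε' < η)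
    {g : ℂ → ℂ} (hg : DifferentiableOn ℂ g (tube η)) (s : ℂ)
    (h : Integrable fun u : ℝ => g (hankelPoint ε u) * contourWeight ε s u)
    (h' : Integrable fun u : ℝ => g (hankelPoint ε' u) * contourWeight ε' s u) :
    contourIntegral ε g s = contourIntegral ε' g s := by
  have hε' : 0 < ε' := hε.trans hlt
  have hlog : Real.log ε ≤ Real.log ε' := Real.log_le_log hε hlt.le
  set f : ℂ → ℂ := fun z => g (Complex.exp z) * Complex.exp (s * z) with hf
  have hmem : ∀ z : ℂ, z.re ≤ Real.log ε' → Complex.exp z ∈ tube η := by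
    intro z hz
    refine mem_tube_of_norm_lt (lt_of_le_of_lt ?_ hεη)
    rw [Complex.norm_exp]
    exact (Real.exp_le_exp.2 hz).trans_eq (Real.exp_log hε')
  have hrect := Complex.integral_boundary_rect_eq_zero_of_differentiableOn f
    ⟨Real.log ε, 0⟩ ⟨Real.log ε', 2 * Real.pi⟩ (by
      intro z hz
      have hz' : z.re ≤ Real.log ε' := by
        have := (Complex.mem_reProdIm.1 hz).1
        rw [Set.uIcc_of_le hlog] at this
        exact this.2
      have hg' : DifferentiableAt ℂ g (Complex.exp z) :=
        hg.differentiableAt ((isOpen_tube η).mem_nhds (hmem z hz'))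
      have h1 : DifferentiableAt ℂ (fun z => g (Complex.exp z)) z :=
        hg'.comp z Complex.differentiableAt_exp
      exact (h1.mul (by fun_prop)).differentiableWithinAt)
  simp only [Complex.ofReal_zero, zero_mul, add_zero, smul_eq_mul] at hrect
  -- the four sides
  have htop : ∀ x : ℝ, f (x + (2 * Real.pi : ℝ) * Complex.I) =
      Complex.exp (2 * Real.pi * Complex.I * s) * f x := by
    intro x
    have e1 : Complex.exp (x + ((2 * Real.pi : ℝ) : ℂ) * Complex.I) = Complex.exp x := by
      push_cast
      exact Complex.exp_periodic _
    simp only [hf, e1]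
    rw [mul_left_comm, ← Complex.exp_add]
    congr 2
    push_cast; ring
  have hray : ∫ x in Real.log ε..Real.log ε', f x = ∫ x in ε..ε', rayIntegrand g s x := by
    have := intervalIntegral.integral_deriv_smul_comp' (f := Real.exp) (f' := Real.exp)
      (g := rayIntegrand g s) (a := Real.log ε) (b := Real.log ε')
      (fun x _ => Real.hasDerivAt_exp x) Real.continuous_exp.continuousOn (by
        have hpos : ∀ x ∈ Real.exp '' Set.uIcc (Real.log ε) (Real.log ε'), 0 < x ∧ x ≤ ε' := by
          rintro _ ⟨y, hy, rfl⟩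
          rw [Set.uIcc_of_le hlog] at hy
          exact ⟨Real.exp_pos y, by rw [← Real.exp_log hε']; exact Real.exp_le_exp.2 hy.2⟩
        unfold rayIntegrand
        refine ContinuousOn.mul ?_ ?_
        · refine hg.continuousOn.comp Complex.continuous_ofReal.continuousOn fun x hx => ?_
          exact ofReal_mem_tube (hε'.trans hεη) (hpos x hx).1.le
        · have hl : ContinuousOn Real.log (Real.exp '' Set.uIcc (Real.log ε) (Real.log ε')) :=
            Real.continuousOn_log.mono fun x hx => (hpos x hx).1.ne'
          fun_prop)
    rw [Real.exp_log hε, Real.exp_log hε'] at this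
    rw [← this]
    congr 1
    funext x
    simp only [hf, Function.comp_apply, rayIntegrand, Real.log_exp, Complex.real_smul,
      Complex.ofReal_exp]
    rw [mul_left_comm, ← Complex.exp_add]
    congr 2
    ring
  have hcirc : ∀ ρ : ℝ, 0 < ρ → Complex.I * ∫ y in (0:ℝ)..2 * Real.pi,
      f (Real.log ρ + y * Complex.I) = circlePart ρ g s := by
    intro ρ hρ
    rw [circlePart, ← intervalIntegral.integral_const_mul]
    congr 1
    funext y
    have e1 : Complex.exp (Real.log ρ + y * Complex.I) = ρ * Complex.exp (Complex.I * y) := by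
      rw [Complex.exp_add, ← Complex.ofReal_exp, Real.exp_log hρ, mul_comm (y : ℂ)]
    have e2 : Complex.exp (s * (Real.log ρ + y * Complex.I)) =
        Complex.exp ((s - 1) * ((Real.log ρ : ℂ) + Complex.I * y)) *
          (ρ * Complex.exp (Complex.I * y)) := by
      rw [← e1, ← Complex.exp_add]
      congr 1; ring
    simp only [hf]
    rw [e2, e1]
    ring
  simp only [htop, intervalIntegral.integral_const_mul, hray, hcirc ε hε, hcirc ε' hε'] at hrect
  have hsub := intervalIntegral.integral_Ioi_sub_Ioi (integrableOn_rayIntegrand h) hlt.le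
  rw [contourIntegral_eq h, contourIntegral_eq h', expPeriod]
  rw [← hsub] at hrect
  linear_combination -hrect

/-- The Hankel integral of a holomorphic function does not depend on the radius. -/
theorem contourIntegral_eq_of_radius {ε ε' η : ℝ} (hε : 0 < ε) (hεη : ε < η) (hε' : 0 < ε')
    (hεη' : ε' < η) {g : ℂ → ℂ} (hg : DifferentiableOn ℂ g (tube η)) (s : ℂ)
    (h : Integrable fun u : ℝ => g (hankelPoint ε u) * contourWeight ε s u)
    (h' : Integrable fun u : ℝ => g (hankelPoint ε' u) * contourWeight ε' s u) :
    contourIntegral ε g s = contourIntegral ε' g s := by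
  rcases lt_trichotomy ε ε' with hlt | rfl | hlt
  · exact contourIntegral_eq_of_lt hε hlt hεη' hg s h h'
  · rfl
  · exact (contourIntegral_eq_of_lt hε' hlt hεη hg s h' h).symm

/-! ### The r-fold integral: holomorphy, zeros, independence of the radii -/

/-- The integral of `limitH γ t ∏ₖ t_k^{s_k - 1} dt_k` over a product of Hankel contours with
radii `ε k`. -/
noncomputable def productIntegral {r : ℕ} (γ : Fin r → ℂ) (ε : Fin r → ℝ) (s : Fin r → ℂ) : ℂ :=
  ∫ u : Fin r → ℝ, limitH γ (contourPoint ε u) * productWeight ε s u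

theorem integrable_limitH_mul {r : ℕ} {γ : Fin r → ℂ} (hγ : ∀ j, 0 < (γ j).re) {η : ℝ} (hη : 0 < η)
    (h : ∀ j, ‖γ j‖ * (r * η) ≤ 3 / 4 * stripRadius (γ j)) {ε : Fin r → ℝ} (hε : ∀ k, 0 < ε k)
    (hεη : ∀ k, ε k < η) (s : Fin r → ℂ) :
    Integrable fun u : Fin r → ℝ => limitH γ (contourPoint ε u) * productWeight ε s u := by
  obtain ⟨A, -, hA⟩ := exists_majorant_bound hγ hη h
  refine ((integrable_majorant_mul hγ hε s).const_mul A).mono' ?_ (ae_of_all _ fun u => ?_)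
  · exact (((measurable_limitH γ).comp (continuous_contourPoint ε).measurable).mul
      (measurable_productWeight ε s)).aestronglyMeasurable
  · rw [norm_mul, ← mul_assoc]
    gcongr
    exact (hA _ fun k => hankelPoint_mem_tube (hε k) (hεη k) (u k)).1

theorem differentiable_productIntegral {r : ℕ} {γ : Fin r → ℂ} (hγ : ∀ j, 0 < (γ j).re) {η : ℝ}
    (hη : 0 < η) (h : ∀ j, ‖γ j‖ * (r * η) ≤ 3 / 4 * stripRadius (γ j)) {ε : Fin r → ℝ}
    (hε : ∀ k, 0 < ε k) (hεη : ∀ k, ε k < η) : Differentiable ℂ (productIntegral γ ε) := by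
  intro s₀
  obtain ⟨A, hA0, hA⟩ := exists_majorant_bound hγ hη h
  obtain ⟨B, hB, hBb⟩ := exists_productWeight_bound hγ hε (‖s₀‖ + 1)
  refine differentiableAt_integral_of_dominated (B := fun u => A * B u) one_pos ?_ ?_
    (hB.const_mul A) (ae_of_all _ fun u s hs => ?_)
  · exact fun s _ => (integrable_limitH_mul hγ hη h hε hεη s).aestronglyMeasurable
  · intro u
    have h1 : ∀ k, Differentiable ℂ fun s : Fin r → ℂ => contourWeight (ε k) (s k) (u k) :=
      fun k => (differentiable_contourWeight (ε k) (u k)).comp (f := fun s : Fin r → ℂ => s k)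
        (by fun_prop)
    have h2 : Differentiable ℂ fun s : Fin r → ℂ => productWeight ε s u := by
      intro s
      exact (HasFDerivAt.finsetProd (u := Finset.univ)
        (g := fun k (s : Fin r → ℂ) => contourWeight (ε k) (s k) (u k))
        fun k _ => (h1 k s).hasFDerivAt).differentiableAt
    exact (h2.const_mul _).differentiableOn
  · have hs' : ‖s‖ ≤ ‖s₀‖ + 1 := by
      have := norm_add_le s₀ (s - s₀)
      rw [add_sub_cancel] at this
      linarith [mem_ball_iff_norm.1 hs]
    calc ‖limitH γ (contourPoint ε u) * productWeight ε s u‖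
        ≤ (A * majorant γ (contourPoint ε u)) * ‖productWeight ε s u‖ := by
          rw [norm_mul]
          gcongr
          exact (hA _ fun k => hankelPoint_mem_tube (hε k) (hεη k) (u k)).1
      _ ≤ A * B u := by
          rw [mul_assoc]
          gcongr
          exact hBb s hs' u

theorem insertNth_mem_tube {n : ℕ} {η : ℝ} (k : Fin (n + 1)) {z : ℂ} {p : Fin n → ℂ}
    (hz : z ∈ tube η) (hp : ∀ i, p i ∈ tube η) (j : Fin (n + 1)) :
    (k.insertNth z p : Fin (n + 1) → ℂ) j ∈ tube η := by
  induction j using Fin.succAboveCases k with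
  | x => simpa using hz
  | p i => simpa using hp i

theorem differentiable_insertNth {n : ℕ} (k : Fin (n + 1)) (p : Fin n → ℂ) :
    Differentiable ℂ fun z : ℂ => (k.insertNth z p : Fin (n + 1) → ℂ) := by
  refine differentiable_pi.2 fun j => ?_
  induction j using Fin.succAboveCases k with
  | x => simp only [Fin.insertNth_apply_same]; fun_prop
  | p i => simp only [Fin.insertNth_apply_succAbove]; fun_prop

theorem differentiableOn_limitH_insertNth {n : ℕ} {γ : Fin (n + 1) → ℂ} (hγ : ∀ j, 0 < (γ j).re)
    {η : ℝ} (hη : 0 < η)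
    (h : ∀ j, ‖γ j‖ * ((n + 1 : ℕ) * η) ≤ 3 / 4 * stripRadius (γ j)) (k : Fin (n + 1))
    {p : Fin n → ℂ} (hp : ∀ i, p i ∈ tube η) :
    DifferentiableOn ℂ (fun z => limitH γ (k.insertNth z p)) (tube η) := by
  intro z hz
  have h1 : DifferentiableAt ℂ (fun z : ℂ => (k.insertNth z p : Fin (n + 1) → ℂ)) z :=
    differentiable_insertNth k p z
  have h2 : DifferentiableAt ℂ (limitH γ) (k.insertNth z p : Fin (n + 1) → ℂ) :=
    differentiableAt_limitH hγ hη h (insertNth_mem_tube k hz hp)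
  exact (DifferentiableAt.fun_comp' z h2 h1).differentiableWithinAt

/-- With the other coordinates frozen, the majorant is a constant times its k-th factor. This gives
integrability for every choice of the frozen coordinates in the tube, not only for almost every one
as Fubini's theorem would. -/
theorem integrable_limitH_insertNth {n : ℕ} {γ : Fin (n + 1) → ℂ} (hγ : ∀ j, 0 < (γ j).re)
    {η : ℝ} (hη : 0 < η)
    (h : ∀ j, ‖γ j‖ * ((n + 1 : ℕ) * η) ≤ 3 / 4 * stripRadius (γ j)) (k : Fin (n + 1))
    {p : Fin n → ℂ} (hp : ∀ i, p i ∈ tube η) {ε : ℝ} (hε : 0 < ε) (hεη : ε < η) (s : ℂ) :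
    Integrable fun u : ℝ =>
      limitH γ (k.insertNth (hankelPoint ε u) p) * contourWeight ε s u := by
  obtain ⟨A, hA0, hA⟩ := exists_majorant_bound hγ hη h
  have hΓ : 0 < ((∑ j ∈ Finset.Iic k, γ j) / 2 : ℂ).re := by
    have : ((∑ j ∈ Finset.Iic k, γ j) / 2 : ℂ).re = (∑ j ∈ Finset.Iic k, (γ j).re) / 2 := by
      rw [← Complex.re_sum]; simp
    rw [this]
    have := Finset.sum_pos (fun j (_ : j ∈ Finset.Iic k) => hγ j) ⟨k, by simp⟩
    linarith
  obtain ⟨C, b, hC, hb, hbound⟩ := exists_contourWeight_bound hε hΓ ‖s‖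
  set P := ∏ i, Real.exp (-(p i * ((∑ j ∈ Finset.Iic (k.succAbove i), γ j) / 2)).re) with hP
  have hP0 : 0 ≤ P := Finset.prod_nonneg fun _ _ => (Real.exp_pos _).le
  refine ((integrable_exp_neg_mul_abs hb).const_mul (A * P * C)).mono' ?_
    (ae_of_all _ fun u => ?_)
  · exact (((measurable_limitH γ).comp ((differentiable_insertNth k p).continuous.comp
      (continuous_hankelPoint ε)).measurable).mul
      (measurable_contourWeight ε s)).aestronglyMeasurable
  · have h1 := (hA _ (insertNth_mem_tube k (hankelPoint_mem_tube hε hεη u) hp)).1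
    rw [majorant, Fin.prod_univ_succAbove _ k] at h1
    simp only [Fin.insertNth_apply_same, Fin.insertNth_apply_succAbove] at h1
    rw [norm_mul]
    calc _ ≤ (A * (Real.exp (-(hankelPoint ε u * ((∑ j ∈ Finset.Iic k, γ j) / 2)).re) * P)) *
          ‖contourWeight ε s u‖ := by gcongr
      _ = A * P * (Real.exp (-(hankelPoint ε u * ((∑ j ∈ Finset.Iic k, γ j) / 2)).re) *
          ‖contourWeight ε s u‖) := by ring
      _ ≤ A * P * (C * Real.exp (-b * |u|)) :=
          mul_le_mul_of_nonneg_left (hbound s le_rfl u) (by positivity)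
      _ = _ := by ring

/-- Fubini's theorem, with the `k`-th variable as the inner one. -/
theorem productIntegral_eq_integral {n : ℕ} {γ : Fin (n + 1) → ℂ} (hγ : ∀ j, 0 < (γ j).re)
    {η : ℝ} (hη : 0 < η)
    (h : ∀ j, ‖γ j‖ * ((n + 1 : ℕ) * η) ≤ 3 / 4 * stripRadius (γ j))
    {ε : Fin (n + 1) → ℝ} (hε : ∀ k, 0 < ε k) (hεη : ∀ k, ε k < η) (k : Fin (n + 1))
    (s : Fin (n + 1) → ℂ) :
    productIntegral γ ε s = ∫ v : Fin n → ℝ,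
      contourIntegral (ε k) (fun z => limitH γ (k.insertNth z
        (contourPoint (fun i => ε (k.succAbove i)) v))) (s k) *
      productWeight (fun i => ε (k.succAbove i)) (fun i => s (k.succAbove i)) v := by
  have hmp := (volume_preserving_piFinSuccAbove (fun _ : Fin (n + 1) => ℝ) k).symm
  have hint := integrable_limitH_mul hγ hη h hε hεη s
  have hpt : ∀ (x : ℝ) (v : Fin n → ℝ), contourPoint ε (k.insertNth x v) =
      k.insertNth (hankelPoint (ε k) x) (contourPoint (fun i => ε (k.succAbove i)) v) := by
    intro x v
    funext j
    induction j using Fin.succAboveCases k with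
    | x => simp [contourPoint]
    | p i => simp [contourPoint]
  have hwt : ∀ (x : ℝ) (v : Fin n → ℝ), productWeight ε s (k.insertNth x v) =
      contourWeight (ε k) (s k) x *
        productWeight (fun i => ε (k.succAbove i)) (fun i => s (k.succAbove i)) v := by
    intro x v
    rw [productWeight, Fin.prod_univ_succAbove _ k]
    simp [productWeight]
  rw [productIntegral, ← hmp.integral_comp' (g := fun u => limitH γ (contourPoint ε u) *
    productWeight ε s u)]
  rw [← hmp.integrable_comp_emb (MeasurableEquiv.measurableEmbedding _)] at hint
  refine (integral_prod_symm _ hint).trans ?_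
  refine integral_congr_ae (ae_of_all _ fun v => ?_)
  simp only [contourIntegral]
  rw [← integral_mul_const]
  refine integral_congr_ae (ae_of_all _ fun x => ?_)
  have he : (MeasurableEquiv.piFinSuccAbove (fun _ : Fin (n + 1) => ℝ) k).symm (x, v) =
      k.insertNth x v := rfl
  simp only [Function.comp_apply, he, hpt, hwt]
  ring

/-- Fubini's theorem with the k-th variable innermost: the inner one-variable integral already
vanishes for all values of the others. -/
theorem productIntegral_eq_zero {r : ℕ} {γ : Fin r → ℂ} (hγ : ∀ j, 0 < (γ j).re) {η : ℝ}
    (hη : 0 < η) (h : ∀ j, ‖γ j‖ * (r * η) ≤ 3 / 4 * stripRadius (γ j)) {ε : Fin r → ℝ}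
    (hε : ∀ k, 0 < ε k) (hεη : ∀ k, ε k < η) (k : Fin r) (s : Fin r → ℂ) (m : ℕ)
    (hs : s k = m + 1) : productIntegral γ ε s = 0 := by
  obtain _ | n := r
  · exact k.elim0
  rw [productIntegral_eq_integral hγ hη h hε hεη k s]
  refine integral_eq_zero_of_ae (ae_of_all _ fun v => ?_)
  have hp : ∀ i, contourPoint (fun i => ε (k.succAbove i)) v i ∈ tube η := fun i =>
    hankelPoint_mem_tube (hε _) (hεη _) _
  simp only [hs, Pi.zero_apply]
  rw [contourIntegral_nat_add_one (hε k) (hεη k)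
    (differentiableOn_limitH_insertNth hγ hη h k hp) m
    (integrable_limitH_insertNth hγ hη h k hp (hε k) (hεη k) _), zero_mul]

theorem productIntegral_update {r : ℕ} {γ : Fin r → ℂ} (hγ : ∀ j, 0 < (γ j).re) {η : ℝ}
    (hη : 0 < η) (h : ∀ j, ‖γ j‖ * (r * η) ≤ 3 / 4 * stripRadius (γ j)) {ε : Fin r → ℝ}
    (hε : ∀ k, 0 < ε k) (hεη : ∀ k, ε k < η) (k : Fin r) {ε' : ℝ} (hε' : 0 < ε') (hεη' : ε' < η)
    (s : Fin r → ℂ) :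
    productIntegral γ (Function.update ε k ε') s = productIntegral γ ε s := by
  obtain _ | n := r
  · exact k.elim0
  have h1 : ∀ j, 0 < Function.update ε k ε' j := by
    intro j
    rcases eq_or_ne j k with rfl | hj
    · simpa using hε'
    · simpa [hj] using hε j
  have h2 : ∀ j, Function.update ε k ε' j < η := by
    intro j
    rcases eq_or_ne j k with rfl | hj
    · simpa using hεη'
    · simpa [hj] using hεη j
  rw [productIntegral_eq_integral hγ hη h hε hεη k s,
    productIntegral_eq_integral hγ hη h h1 h2 k s]
  simp only [Function.update_self, Function.update_of_ne (Fin.succAbove_ne k _)]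
  refine integral_congr_ae (ae_of_all _ fun v => ?_)
  have hp : ∀ i, contourPoint (fun i => ε (k.succAbove i)) v i ∈ tube η := fun i =>
    hankelPoint_mem_tube (hε _) (hεη _) _
  simp only
  rw [contourIntegral_eq_of_radius hε' hεη' (hε k) (hεη k)
    (differentiableOn_limitH_insertNth hγ hη h k hp) (s k)
    (integrable_limitH_insertNth hγ hη h k hp hε' hεη' _)
    (integrable_limitH_insertNth hγ hη h k hp (hε k) (hεη k) _)]

/-- The integral does not depend on the radii of the circles. -/
theorem productIntegral_const_eq {r : ℕ} {γ : Fin r → ℂ} (hγ : ∀ j, 0 < (γ j).re) {η : ℝ}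
    (hη : 0 < η) (h : ∀ j, ‖γ j‖ * (r * η) ≤ 3 / 4 * stripRadius (γ j)) {ε ε' : ℝ}
    (hε : 0 < ε) (hεη : ε < η) (hε' : 0 < ε') (hεη' : ε' < η) (s : Fin r → ℂ) :
    productIntegral γ (fun _ => ε') s = productIntegral γ (fun _ => ε) s := by
  classical
  -- The radii are changed one coordinate at a time, S being the set of coordinates already changed;
  -- this is why the contours are allowed different radii.
  have key : ∀ S : Finset (Fin r), productIntegral γ (fun k => if k ∈ S then ε' else ε) s =
      productIntegral γ (fun _ => ε) s := by
    intro S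
    induction S using Finset.induction_on with
    | empty => simp
    | insert k S hk ih =>
      rw [← ih, ← productIntegral_update hγ hη h (ε := fun k => if k ∈ S then ε' else ε)
        (fun j => by split_ifs <;> assumption)
        (fun j => by split_ifs <;> assumption) k hε' hεη' s]
      congr 1
      funext j
      rcases eq_or_ne j k with rfl | hj
      · simp
      · simp [hj]
  simpa using key Finset.univ

/-! ### Removing all poles -/

/-- An entire function that vanishes on the hyperplanes `s_k = 1, 2, 3, …` remains entire after
multiplication by the factors `1/((e^{2πis_k} - 1)Γ(s_k))`. -/
theorem exists_differentiable_prod_hankelFactor_mul {ι : Type*} [Fintype ι]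
    {b : (ι → ℂ) → ℂ} (hb : Differentiable ℂ b)
    (hzero : ∀ k, ∀ s : ι → ℂ, ∀ m : ℕ, s k = m + 1 → b s = 0) (S : Finset ι) :
    ∃ F : (ι → ℂ) → ℂ, Differentiable ℂ F ∧ ∀ s : ι → ℂ, (∀ k ∈ S, ∀ m : ℕ, s k ≠ m + 1) →
      F s = (∏ k ∈ S, hankelFactor (s k)) * b s := by
  classical
  induction S using Finset.induction_on with
  | empty => exact ⟨b, hb, fun s _ => by simp⟩
  | insert k S hk ih =>
    obtain ⟨F, hF, hFs⟩ := ih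
    have hF0 : ∀ s : ι → ℂ, ∀ m : ℕ, s k = m + 1 → F s = 0 := by
      intro s m hs
      -- The product formula for F holds only off the poles in the coordinates of S. Shifting those
      -- coordinates by iτ makes them nonreal for small τ ≠ 0 and leaves s_k alone, as k ∉ S. So F
      -- vanishes at the shifted points, and by continuity at s.
      set w : ℝ → ι → ℂ := fun τ j => if j ∈ S then s j + Complex.I * τ else s j with hw
      have hwc : Continuous w := by
        refine continuous_pi fun j => ?_
        simp only [hw]
        split_ifs <;> fun_prop
      have hw0 : w 0 = s := by
        funext j; simp [hw]
      have hlim : Tendsto (fun τ => F (w τ)) (𝓝[≠] 0) (𝓝 (F s)) := by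
        have := (hF.continuous.comp hwc).tendsto 0
        rw [Function.comp_apply, hw0] at this
        exact this.mono_left nhdsWithin_le_nhds
      have hev : ∀ᶠ τ : ℝ in 𝓝[≠] 0, ∀ j, τ ≠ -(s j).im := by
        refine eventually_all.2 fun j => ?_
        rcases eq_or_ne (-(s j).im) 0 with h0 | h0
        · rw [h0]; exact eventually_mem_nhdsWithin
        · exact eventually_nhdsWithin_of_eventually_nhds (eventually_ne_nhds h0.symm)
      refine tendsto_nhds_unique hlim (tendsto_const_nhds.congr' ?_)
      filter_upwards [hev] with τ hτ
      rw [hFs (w τ), hzero k (w τ) m (by simp [hw, hk, hs]), mul_zero]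
      intro j hj n hn
      have := congrArg Complex.im hn
      simp only [hw, if_pos hj] at this
      simp at this
      exact hτ j (by linarith)
    obtain ⟨F', hF', hFs'⟩ := exists_differentiable_hankelFactor_mul hF k hF0
    refine ⟨F', hF', fun s hs => ?_⟩
    rw [hFs' s (hs k (Finset.mem_insert_self k S)),
      hFs s fun j hj => hs j (Finset.mem_insert_of_mem hj), Finset.prod_insert hk, mul_assoc]

/-! ### The limit c → 1 under the integral sign -/

theorem norm_inv_pow_mul_tildeH {r : ℕ} (γ t : Fin r → ℂ) (c : ℝ) :
    ‖(((c : ℂ) - 1) ^ r)⁻¹ * tildeH γ c t‖ = ‖(-1) ^ r / ((c : ℂ) - 1) ^ r * tildeH γ c t‖ := by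
  simp [div_eq_mul_inv]

theorem eventually_near_one : ∀ᶠ c : ℝ in 𝓝[≠] 1, c ≠ 1 ∧ |c - 1| < 1 / 3 :=
  eventually_mem_nhdsWithin.and (eventually_nhdsWithin_of_eventually_nhds (by
    filter_upwards [Metric.ball_mem_nhds (1 : ℝ) (show (0 : ℝ) < 1 / 3 by norm_num)] with c hc
    simpa [Real.dist_eq] using hc))

theorem hankelIntegrable_tildeH {r : ℕ} {γ : Fin r → ℂ} (hγ : ∀ j, 0 < (γ j).re) {η : ℝ}
    (hη : 0 < η) (h : ∀ j, ‖γ j‖ * (r * η) ≤ 3 / 4 * stripRadius (γ j)) {ε : ℝ}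
    (hε : 0 < ε) (hεη : ε < η) {c : ℝ} (hc : c ≠ 1) (hc3 : |c - 1| < 1 / 3) (s : Fin r → ℂ) :
    HankelIntegrable ε s (tildeH γ c) := by
  obtain ⟨A, -, hA⟩ := exists_majorant_bound hγ hη h
  have hc' : ((c : ℂ) - 1) ^ r ≠ 0 := pow_ne_zero _ (by rw [sub_ne_zero]; exact_mod_cast hc)
  have hmaj := (integrable_majorant_mul hγ (ε := fun _ : Fin r => ε) (fun _ => hε) s).const_mul
    (‖((c : ℂ) - 1) ^ r‖ * A)
  refine hmaj.mono' ?_ (ae_of_all _ fun u => ?_)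
  · exact ((measurable_tildeH γ c).comp (continuous_contourPoint fun _ => ε).measurable).mul
      (measurable_productWeight (fun _ => ε) s) |>.aestronglyMeasurable
  · have h1 := (hA (hankelPoints ε u) fun k => hankelPoint_mem_tube hε hεη (u k)).2 c hc hc3
    rw [← norm_inv_pow_mul_tildeH, norm_mul, norm_inv, inv_mul_le_iff₀ (norm_pos_iff.2 hc')] at h1
    rw [norm_mul, ← mul_assoc, mul_assoc ‖((c : ℂ) - 1) ^ r‖]
    exact mul_le_mul_of_nonneg_right h1 (norm_nonneg _)

theorem tendsto_hankelIntegral_tildeH {r : ℕ} {γ : Fin r → ℂ} (hγ : ∀ j, 0 < (γ j).re) {η : ℝ}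
    (hη : 0 < η) (h : ∀ j, ‖γ j‖ * (r * η) ≤ 3 / 4 * stripRadius (γ j)) {ε : ℝ}
    (hε : 0 < ε) (hεη : ε < η) (s : Fin r → ℂ) :
    Tendsto (fun c : ℝ => (-1) ^ r / ((c : ℂ) - 1) ^ r * hankelIntegral ε s (tildeH γ c))
      (𝓝[≠] 1) (𝓝 (productIntegral γ (fun _ => ε) s)) := by
  obtain ⟨A, -, hA⟩ := exists_majorant_bound hγ hη h
  have hmem : ∀ u : Fin r → ℝ, ∀ k, hankelPoints ε u k ∈ tube η := fun u k =>
    hankelPoint_mem_tube hε hεη (u k)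
  simp only [hankelIntegral, ← integral_const_mul]
  refine tendsto_integral_filter_of_dominated_convergence
    (fun u => A * (majorant γ (hankelPoints ε u) * ‖hankelWeight ε s u‖)) ?_ ?_ ?_ ?_
  · filter_upwards [eventually_near_one] with c hc
    exact (hankelIntegrable_tildeH hγ hη h hε hεη hc.1 hc.2 s).aestronglyMeasurable.const_mul _
  · filter_upwards [eventually_near_one] with c hc
    refine ae_of_all _ fun u => ?_
    rw [← mul_assoc, norm_mul, ← mul_assoc]
    exact mul_le_mul_of_nonneg_right ((hA _ (hmem u)).2 c hc.1 hc.2) (norm_nonneg _)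
  · exact (integrable_majorant_mul hγ (ε := fun _ : Fin r => ε) (fun _ => hε) s).const_mul A
  · refine ae_of_all _ fun u => ?_
    simp only [← mul_assoc]
    exact (tendsto_tildeH hγ hη h (hmem u)).mul_const _

end DesZeta

theorem theorem2 (r : ℕ) (γ : Fin r → ℂ) (hγ : ∀ j, 0 < (γ j).re) :
    ∃ ε₀ : ℝ, 0 < ε₀ ∧
      -- for every Hankel contour whose circle is small enough:
      (∀ ε : ℝ, 0 < ε → ε < ε₀ →
        -- domination by an exponential majorant independent of `c`,
        (∃ δ : ℝ, 0 < δ ∧ ∃ A : ℝ, 0 < A ∧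
          (∀ c : ℝ, c ≠ 1 → |c - 1| < δ → ∀ u : Fin r → ℝ,
            ‖(((c : ℂ) - 1) ^ r)⁻¹ * DesZeta.tildeH γ c (DesZeta.hankelPoints ε u)‖
              ≤ A * DesZeta.majorant γ (DesZeta.hankelPoints ε u)) ∧
          (∀ s : Fin r → ℂ, MeasureTheory.Integrable (fun u : Fin r → ℝ =>
            A * DesZeta.majorant γ (DesZeta.hankelPoints ε u) * ‖DesZeta.hankelWeight ε s u‖)) ∧
          -- absolute convergence of the contour integrals for `c` near `1`,
          (∀ c : ℝ, c ≠ 1 → |c - 1| < δ → ∀ s : Fin r → ℂ,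
            DesZeta.HankelIntegrable ε s (DesZeta.tildeH γ c))) ∧
        -- existence of the limits under the integral signs,
        (∀ u : Fin r → ℝ,
          (∃ l : ℂ, Filter.Tendsto (fun c : ℝ => (-1) ^ r / ((c : ℂ) - 1) ^ r *
              DesZeta.tildeH γ c (DesZeta.hankelPoints ε u))
            (nhdsWithin 1 {1}ᶜ) (nhds l)) ∧
          ∀ j : Fin r, ∃ l : ℂ, Filter.Tendsto (fun c : ℝ => (-1) / ((c : ℂ) - 1) *
              DesZeta.kernel c (DesZeta.tailArg γ (DesZeta.hankelPoints ε u) j))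
            (nhdsWithin 1 {1}ᶜ) (nhds l)) ∧
        -- absolute convergence of the integrals of the limits,
        (∀ s : Fin r → ℂ,
          DesZeta.HankelIntegrable ε s (fun t => limUnder (nhdsWithin (1 : ℝ) {1}ᶜ)
            (fun c : ℝ => (-1) ^ r / ((c : ℂ) - 1) ^ r * DesZeta.tildeH γ c t)) ∧
          DesZeta.HankelIntegrable ε s (fun t => ∏ j, limUnder (nhdsWithin (1 : ℝ) {1}ᶜ)
            (fun c : ℝ => (-1) / ((c : ℂ) - 1) * DesZeta.kernel c (DesZeta.tailArg γ t j)))) ∧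
        -- existence of the limit that defines the function, and the two formulas for it
        (∀ s ∈ DesZeta.regularPoints r,
          Filter.Tendsto (fun c : ℝ => DesZeta.preDesZeta ε γ c s)
            (nhdsWithin 1 {1}ᶜ) (nhds (DesZeta.desZeta ε γ s)) ∧
          DesZeta.desZeta ε γ s = (∏ k, DesZeta.hankelFactor (s k)) *
            DesZeta.hankelIntegral ε s (fun t => limUnder (nhdsWithin (1 : ℝ) {1}ᶜ)
              (fun c : ℝ => (-1) ^ r / ((c : ℂ) - 1) ^ r * DesZeta.tildeH γ c t)) ∧
          DesZeta.desZeta ε γ s = (∏ k, DesZeta.hankelFactor (s k)) *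
            DesZeta.hankelIntegral ε s (fun t => ∏ j, limUnder (nhdsWithin (1 : ℝ) {1}ᶜ)
              (fun c : ℝ =>
                (-1) / ((c : ℂ) - 1) * DesZeta.kernel c (DesZeta.tailArg γ t j))))) ∧
      -- and the function extends to an entire function, the same for all small `ε`
      ∃ Z : (Fin r → ℂ) → ℂ, Differentiable ℂ Z ∧
        ∀ ε : ℝ, 0 < ε → ε < ε₀ → ∀ s ∈ DesZeta.regularPoints r,
          Z s = DesZeta.desZeta ε γ s := by
  obtain ⟨η, hη, h⟩ := DesZeta.exists_tube_radius hγ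
  have hmem : ∀ ε : ℝ, 0 < ε → ε < η → ∀ (u : Fin r → ℝ) k, DesZeta.hankelPoints ε u k ∈
      DesZeta.tube η := fun ε hε hεη u k => DesZeta.hankelPoint_mem_tube hε hεη (u k)
  have hlimH : ∀ ε : ℝ, 0 < ε → ε < η → ∀ u : Fin r → ℝ,
      limUnder (nhdsWithin (1 : ℝ) {1}ᶜ) (fun c : ℝ => (-1) ^ r / ((c : ℂ) - 1) ^ r *
        DesZeta.tildeH γ c (DesZeta.hankelPoints ε u)) =
      DesZeta.limitH γ (DesZeta.hankelPoints ε u) := fun ε hε hεη u =>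
    (DesZeta.tendsto_tildeH hγ hη h (hmem ε hε hεη u)).limUnder_eq
  have hker : ∀ ε : ℝ, 0 < ε → ε < η → ∀ (u : Fin r → ℝ) (j : Fin r),
      Filter.Tendsto (fun c : ℝ => (-1) / ((c : ℂ) - 1) *
        DesZeta.kernel c (DesZeta.tailArg γ (DesZeta.hankelPoints ε u) j))
        (nhdsWithin 1 {1}ᶜ)
        (nhds (DesZeta.toddDeriv (DesZeta.tailArg γ (DesZeta.hankelPoints ε u) j))) :=
    fun ε hε hεη u j => DesZeta.tendsto_kernel (hγ j)
      (DesZeta.tailArg_mem_halfStrip hη h (hmem ε hε hεη u) j)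
  have hlimK : ∀ ε : ℝ, 0 < ε → ε < η → ∀ u : Fin r → ℝ,
      ∏ j, limUnder (nhdsWithin (1 : ℝ) {1}ᶜ) (fun c : ℝ => (-1) / ((c : ℂ) - 1) *
        DesZeta.kernel c (DesZeta.tailArg γ (DesZeta.hankelPoints ε u) j)) =
      DesZeta.limitH γ (DesZeta.hankelPoints ε u) := fun ε hε hεη u =>
    Finset.prod_congr rfl fun j _ => (hker ε hε hεη u j).limUnder_eq
  have hint : ∀ ε : ℝ, 0 < ε → ε < η → ∀ s : Fin r → ℂ,
      DesZeta.HankelIntegrable ε s (DesZeta.limitH γ) := fun ε hε hεη s =>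
    DesZeta.integrable_limitH_mul hγ hη h (ε := fun _ => ε) (fun _ => hε) (fun _ => hεη) s
  have hpre : ∀ ε : ℝ, 0 < ε → ε < η → ∀ s : Fin r → ℂ,
      Filter.Tendsto (fun c : ℝ => DesZeta.preDesZeta ε γ c s) (nhdsWithin 1 {1}ᶜ)
        (nhds ((∏ k, DesZeta.hankelFactor (s k)) * DesZeta.productIntegral γ (fun _ => ε) s)) := by
    intro ε hε hεη s
    refine ((DesZeta.tendsto_hankelIntegral_tildeH hγ hη h hε hεη s).const_mul _).congr fun c => ?_
    rw [DesZeta.preDesZeta]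
    ring
  have hdes : ∀ ε : ℝ, 0 < ε → ε < η → ∀ s : Fin r → ℂ, DesZeta.desZeta ε γ s =
      (∏ k, DesZeta.hankelFactor (s k)) * DesZeta.productIntegral γ (fun _ => ε) s :=
    fun ε hε hεη s => (hpre ε hε hεη s).limUnder_eq
  refine ⟨η, hη, fun ε hε hεη => ⟨?_, ?_, ?_, ?_⟩, ?_⟩
  · obtain ⟨A, hA, hbound⟩ := DesZeta.exists_majorant_bound hγ hη h
    refine ⟨1 / 3, by norm_num, A, hA, ?_, ?_, ?_⟩
    · intro c hc hc3 u
      rw [DesZeta.norm_inv_pow_mul_tildeH]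
      exact (hbound _ (hmem ε hε hεη u)).2 c hc hc3
    · intro s
      simp only [mul_assoc]
      exact (DesZeta.integrable_majorant_mul hγ (ε := fun _ : Fin r => ε)
        (fun _ => hε) s).const_mul A
    · exact fun c hc hc3 s => DesZeta.hankelIntegrable_tildeH hγ hη h hε hεη hc hc3 s
  · exact fun u => ⟨⟨_, DesZeta.tendsto_tildeH hγ hη h (hmem ε hε hεη u)⟩,
      fun j => ⟨_, hker ε hε hεη u j⟩⟩
  · intro s
    simp only [DesZeta.HankelIntegrable, hlimH ε hε hεη, hlimK ε hε hεη]
    exact ⟨hint ε hε hεη s, hint ε hε hεη s⟩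
  · intro s _
    simp only [DesZeta.hankelIntegral, hlimH ε hε hεη, hlimK ε hε hεη, hdes ε hε hεη s]
    exact ⟨hpre ε hε hεη s, rfl, rfl⟩
  -- The entire extension is built from the single radius η/2; independence of the radius then
  -- identifies it with the function for every ε < η.
  · obtain ⟨Z, hZ, hZs⟩ := DesZeta.exists_differentiable_prod_hankelFactor_mul
      (DesZeta.differentiable_productIntegral hγ hη h (ε := fun _ => η / 2)
        (fun _ => half_pos hη) fun _ => half_lt_self hη)
      (fun k s m hs => DesZeta.productIntegral_eq_zero hγ hη h (ε := fun _ => η / 2)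
        (fun _ => half_pos hη) (fun _ => half_lt_self hη) k s m hs) Finset.univ
    refine ⟨Z, hZ, fun ε hε hεη s hs => ?_⟩
    rw [hZs s fun k _ => hs k, hdes ε hε hεη s,
      DesZeta.productIntegral_const_eq hγ hη h (half_pos hη) (half_lt_self hη) hε hεη s]
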